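/- For $m \ge 1$ let $P_m$ denote the path with $m$ edges (and $m+1$ vertices). For positive integers $n$ and $k$, let $\mathrm{bal}_3(n, P_{3k})$ be the least non-negative integer $m$ with the following property: every colouring of the edges of the complete graph $K_n$ with three colours, in which each of the three colours appears on more than $m$ edges, contains a balanced copy of $P_{3k}$, that is, a (not necessarily induced) path with $3k$ edges on which each of the three colours appears exactly $k$ times. **Theorem.** For every fixed integer $k \ge 1$, $$\left(\frac{k-1}{2} + o(1)\right) n \;\le\; \mathrm{bal}_3(n, P_{3k}) \;\le\; (k + o(1))\, n \qquad (n \to \infty),$$ where each $o(1)$ stands for a real function of $n$ (which may depend on $k$) that tends to $0$ as $n \to \infty$. -/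

import Mathlib

open Filter Topology

namespace BalancedPaths

/-- The number of edges that receive the colour `i` in the edge-colouring `C`. -/
noncomputable def colorCount {V K : Type} {G : SimpleGraph V} (C : G.EdgeLabeling K) (i : K) : ℕ :=
  Nat.card {e : G.edgeSet // C e = i}

/-- A finite graph whose edges are coloured (arbitrarily) with the `r` colours `Fin r`. -/
structure ColoredGraph (r : ℕ) where
  order : ℕ
  graph : SimpleGraph (Fin order)
  color : graph.EdgeLabeling (Fin r)

/-- The `r`-edge-coloured complete graph `C` on `n` vertices contains the coloured graph `H`:
there is a (not necessarily induced) copy of `H` in `K_n` whose edges carry the colours of `H`. -/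
def Contains {r n : ℕ} (C : SimpleGraph.TopEdgeLabeling (Fin n) (Fin r))
    (H : ColoredGraph r) : Prop :=
  ∃ f : SimpleGraph.Copy H.graph (⊤ : SimpleGraph (Fin n)), ∀ e, C (f.mapEdgeSet e) = H.color e

/-- `m` is a threshold for `F` if every `r`-edge-colouring of `K_n` with more than `m` edges of
each of the `r` colours contains a member of `F`. -/
def IsThreshold (r n : ℕ) (F : Set (ColoredGraph r)) (m : ℕ) : Prop :=
  ∀ C : SimpleGraph.TopEdgeLabeling (Fin n) (Fin r),
    (∀ i, m < colorCount C i) → ∃ H ∈ F, Contains C H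

/-- `ex_r(K_n, F)`: the least threshold for `F`, and `∞` if there is none. -/
noncomputable def coloredEx (r n : ℕ) (F : Set (ColoredGraph r)) : ℕ∞ :=
  ⨅ (m : ℕ) (_ : IsThreshold r n F m), (m : ℕ∞)

/-- Each of the `r` colours appears on precisely `⌊e(G)/r⌋` or `⌈e(G)/r⌉` edges of `G`. -/
def IsBalanced {V : Type} {r : ℕ} {G : SimpleGraph V} (C : G.EdgeLabeling (Fin r)) : Prop :=
  ∀ i, colorCount C i = Nat.card G.edgeSet / r ∨ colorCount C i = Nat.card G.edgeSet ⌈/⌉ r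

/-- The family of all balanced `r`-coloured copies of `G`. -/
def balancedFamily {V : Type} (r : ℕ) (G : SimpleGraph V) : Set (ColoredGraph r) :=
  {H | Nonempty (H.graph ≃g G) ∧ IsBalanced H.color}

/-- The `r`-balancing number `bal_r(n, G)`. -/
noncomputable def balancingNumber {V : Type} (r n : ℕ) (G : SimpleGraph V) : ℕ∞ :=
  coloredEx r n (balancedFamily r G)

/-- The path with `m` edges, that is, with `m + 1` vertices. -/
abbrev path (m : ℕ) : SimpleGraph (Fin (m + 1)) := SimpleGraph.pathGraph (m + 1)

end BalancedPaths

/-!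
The three-colour balancing number of a path with `3 * k` edges is between `(k - 1) / 2 * n` and
`k * n`, up to lower order terms.

*Lower bound.* Choose `k - 1` vertices and colour the edges between them and the rest evenly with
two colours, all other edges with the third. A path has at most `2 * (k - 1)` edges at the chosen
vertices, so the first two colours together occur fewer than `2 * k` times on it
(`not_contains_starColoring`).

*Upper bound.* Suppose that each colour has at least `k * n + O(n ^ (3 / 4))` edges; for `k = 1` it
is enough that all colours occur (`HasBalancedPath.one`). A colour with many edges has a *rich* set,
a set of vertices in which all degrees in that colour are large, and a path that reaches a rich set
can be prolonged by any number of edges of its colour.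

* If all colours are rich, start in one rich set, cross the second one and end in the third one.
  What can go wrong is the parity of the number of edges in the middle set. If this fails for two
  choices of the middle set, then edges between these two sets would need to have two
  colours (`HasBalancedPath.of_three_rich`).
* If one colour has `O(n)` edges and the others are rich, almost all vertices have small degree in
  the rare colour. The rare edges of the path either form a path found by the Erdős–Gallai theorem
  or are pairs of edges at *hubs*, vertices of large degree in the rare colour; the two ends are
  then prolonged in the rich sets (`HasBalancedPath.of_one_rare`).
* If two colours are rare, almost all edges at almost all vertices have the third colour. Up to `k`
  components consisting of rare edges can then be linked by edges of the third colour. If a rare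
  colour has `s < k` hubs, at least `(k - s) * n` of its edges avoid them, so the Erdős–Gallai
  theorem gives a path with `2 * (k - s) + 1` edges of that colour outside the hubs, which makes up
  for the missing hubs (`HasBalancedPath.of_two_rare`).

Paths are lists of vertices without repetition that grow at the head; colourings are functions on
unordered pairs of vertices whose values on the diagonal are irrelevant.
-/

set_option linter.unusedSectionVars false

namespace BalancedPaths

open Finset

/-! ### Degree sums, dense subgraphs and the Erdős–Gallai theorem -/

section Volume

variable {V : Type*} [DecidableEq V] (G : SimpleGraph V) [DecidableRel G.Adj]

/-- The number of neighbours of `x` inside `S`. -/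
def innerDegree (S : Finset V) (x : V) : ℕ := #{y ∈ S | G.Adj x y}

/-- The sum of the degrees of the subgraph induced on `S`, that is, twice its number of edges. -/
def volume (S : Finset V) : ℕ := ∑ x ∈ S, innerDegree G S x

variable {G}

lemma innerDegree_mono {S S' : Finset V} (h : S ⊆ S') (x : V) :
    innerDegree G S x ≤ innerDegree G S' x :=
  card_le_card (filter_subset_filter _ h)

lemma innerDegree_sdiff_add {S X : Finset V} (h : X ⊆ S) (x : V) :
    innerDegree G (S \ X) x + innerDegree G X x = innerDegree G S x := by
  unfold innerDegree
  rw [← card_union_of_disjoint]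
  · rw [← filter_union, sdiff_union_of_subset h]
  · exact disjoint_filter_filter sdiff_disjoint

lemma sum_innerDegree_comm (S X : Finset V) :
    ∑ x ∈ S, innerDegree G X x = ∑ x ∈ X, innerDegree G S x := by
  have := sum_card_bipartiteAbove_eq_sum_card_bipartiteBelow (s := S) (t := X) G.Adj
  simpa [innerDegree, bipartiteAbove, bipartiteBelow, G.adj_comm] using this

lemma volume_eq_sdiff {S X : Finset V} (h : X ⊆ S) :
    volume G S = volume G (S \ X) + ∑ x ∈ X, innerDegree G (S \ X) x
      + ∑ x ∈ X, innerDegree G S x := by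
  have h1 : volume G S = ∑ x ∈ S \ X, innerDegree G S x + ∑ x ∈ X, innerDegree G S x :=
    (sum_sdiff h).symm
  rw [h1, ← sum_innerDegree_comm (S \ X) X, volume, ← sum_add_distrib]
  simp_rw [innerDegree_sdiff_add h]

lemma volume_le_sdiff {S X : Finset V} (h : X ⊆ S) :
    volume G S ≤ volume G (S \ X) + 2 * ∑ x ∈ X, innerDegree G S x := by
  have h2 : ∑ x ∈ X, innerDegree G (S \ X) x ≤ ∑ x ∈ X, innerDegree G S x :=
    sum_le_sum fun x _ => innerDegree_mono sdiff_subset x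
  have := volume_eq_sdiff (G := G) h
  omega

lemma volume_eq_sdiff_of_closed {S X : Finset V} (h : X ⊆ S)
    (hc : ∀ x ∈ X, ∀ y ∈ S \ X, ¬ G.Adj x y) :
    volume G S = volume G (S \ X) + volume G X := by
  have h0 : ∀ x ∈ X, innerDegree G (S \ X) x = 0 := fun x hx => by
    rw [innerDegree, card_eq_zero, filter_eq_empty_iff]
    exact fun y hy => hc x hx y hy
  have h1 : ∑ x ∈ X, innerDegree G (S \ X) x = 0 := sum_eq_zero h0
  have h2 : ∑ x ∈ X, innerDegree G S x = volume G X := by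
    refine sum_congr rfl fun x hx => ?_
    rw [← innerDegree_sdiff_add h, h0 x hx, zero_add]
  rw [volume_eq_sdiff h, h1, h2, add_zero]

lemma volume_le_card_mul (X : Finset V) : volume G X ≤ #X * (#X - 1) := by
  refine sum_le_card_nsmul _ _ _ fun x hx => ?_
  rw [← card_erase_of_mem hx]
  refine card_le_card fun y hy => ?_
  rw [mem_filter] at hy
  exact mem_erase.2 ⟨hy.2.ne', hy.1⟩

/-- A graph of large average degree has a subgraph of large minimum degree. -/
lemma exists_minDegree_subset {d : ℕ} (S : Finset V) (h : 2 * d * #S < volume G S) :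
    ∃ Q ⊆ S, Q.Nonempty ∧ ∀ x ∈ Q, d < innerDegree G Q x := by
  induction S using Finset.strongInduction with
  | H S ih =>
    by_cases hS : ∀ x ∈ S, d < innerDegree G S x
    · refine ⟨S, subset_rfl, ?_, hS⟩
      by_contra hne
      rw [not_nonempty_iff_eq_empty] at hne
      simp [hne, volume] at h
    · push Not at hS
      obtain ⟨x, hx, hd⟩ := hS
      have h1 := volume_le_sdiff (G := G) (singleton_subset_iff.2 hx)
      rw [sum_singleton, sdiff_singleton_eq_erase] at h1
      have h2 : #(S.erase x) + 1 = #S := card_erase_add_one hx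
      obtain ⟨Q, hQ, h3⟩ := ih (S.erase x) (erase_ssubset hx) (by
        rw [← h2, mul_add] at h; omega)
      exact ⟨Q, hQ.trans (erase_subset _ _), h3⟩

/-- `l` lists the vertices of a path of `G` that lies in `S`. -/
def IsPathIn (G : SimpleGraph V) (S : Finset V) (l : List V) : Prop :=
  l.Nodup ∧ l.IsChain G.Adj ∧ ∀ x ∈ l, x ∈ S

lemma IsPathIn.mono {S S' : Finset V} {l : List V} (hl : IsPathIn G S l) (h : S ⊆ S') :
    IsPathIn G S' l :=
  ⟨hl.1, hl.2.1, fun x hx => h (hl.2.2 x hx)⟩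

lemma IsPathIn.reverse {S : Finset V} {l : List V} (hl : IsPathIn G S l) :
    IsPathIn G S l.reverse := by
  refine ⟨List.nodup_reverse.2 hl.1, ?_, fun x hx => hl.2.2 x (List.mem_reverse.1 hx)⟩
  rw [List.isChain_reverse]
  exact hl.2.1.imp fun _ _ h => h.symm

/-- A path that cannot be prolonged contains all neighbours of its first vertex. -/
lemma innerDegree_le_of_maximal {S : Finset V} {L : ℕ} {x : V} {l : List V}
    (hl : IsPathIn G S (x :: l)) (hL : (x :: l).length = L + 1)
    (hmax : ¬ ∃ l', IsPathIn G S l' ∧ l'.length = L + 2) :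
    innerDegree G S x ≤ #{i ∈ range L | G.Adj x ((x :: l).getD (i + 1) x)} := by
  refine le_trans (card_le_card (t := image (fun i => (x :: l).getD (i + 1) x)
    {i ∈ range L | G.Adj x ((x :: l).getD (i + 1) x)}) fun z hz => ?_) card_image_le
  rw [mem_filter] at hz
  have hzl : z ∈ x :: l := by
    by_contra hzl
    refine hmax ⟨z :: x :: l, ⟨List.nodup_cons.2 ⟨hzl, hl.1⟩,
      List.isChain_cons_cons.2 ⟨hz.2.symm, hl.2.1⟩, ?_⟩, by simp at hL ⊢; omega⟩
    intro y hy
    rcases List.mem_cons.1 hy with rfl | hy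
    · exact hz.1
    · exact hl.2.2 y hy
  have hzl' : z ∈ l := (List.mem_cons.1 hzl).resolve_left hz.2.ne'
  obtain ⟨j, hj, rfl⟩ := List.getElem_of_mem hzl'
  simp at hL
  rw [mem_image]
  refine ⟨j, mem_filter.2 ⟨mem_range.2 (by omega), ?_⟩, ?_⟩
  · simpa [List.getElem?_eq_getElem hj] using hz.2
  · simp [List.getElem?_eq_getElem hj]

lemma innerDegree_head_le {S : Finset V} {L : ℕ} {p : List V}
    (hp : IsPathIn G S p) (hL : p.length = L + 1)
    (hmax : ¬ ∃ l', IsPathIn G S l' ∧ l'.length = L + 2) :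
    innerDegree G S p[0] ≤ ∑ i ∈ range L, if G.Adj p[0] (p.getD (i + 1) p[0]) then 1 else 0 := by
  rw [← card_filter]
  match p, hL with
  | x :: l, hL => exact innerDegree_le_of_maximal hp hL hmax

/-- If consecutive vertices of the cyclic list `q` are adjacent and no path in `S` is longer, then
no edge leaves the vertex set of `q` inside `S`. -/
lemma closed_of_cycle {S : Finset V} {L : ℕ} {q : List V}
    (hq : IsPathIn G S q) (hL : q.length = L + 1)
    (hcyc : ∀ a ∈ q.getLast?, ∀ b ∈ q.head?, G.Adj a b)
    (hmax : ¬ ∃ l', IsPathIn G S l' ∧ l'.length = L + 2) :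
    ∀ w ∈ q, ∀ z ∈ S, z ∉ q → ¬ G.Adj w z := by
  intro w hw z hz hzq hwz
  obtain ⟨u, v, rfl⟩ := List.append_of_mem hw
  obtain ⟨hnd, hch, hS⟩ := hq
  refine hmax ⟨z :: (w :: v ++ u), ⟨?_, ?_, ?_⟩, ?_⟩
  · rw [List.nodup_cons]
    refine ⟨fun h => hzq ?_, List.nodup_append_comm.1 hnd⟩
    simp only [List.mem_append] at h ⊢
    exact h.symm
  · rw [List.cons_append, List.isChain_cons_cons]
    refine ⟨hwz.symm, ?_⟩
    rw [← List.cons_append]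
    rw [List.isChain_append] at hch ⊢
    refine ⟨hch.2.1, hch.1, fun a ha b hb => hcyc a ?_ b ?_⟩
    · rw [List.getLast?_append]
      rw [Option.mem_def] at ha
      simp [ha]
    · rw [List.head?_append]
      rw [Option.mem_def] at hb
      simp [hb]
  · intro y hy
    rcases List.mem_cons.1 hy with rfl | hy
    · exact hz
    · refine hS y ?_
      simp only [List.mem_append] at hy ⊢
      exact hy.symm
  · simp at hL ⊢
    omega

/-- The rotation step: a path that cannot be prolonged and whose ends have large degree can be
turned into a cycle on the same vertices, so that no edge leaves it. -/
lemma closed_of_maximal {S : Finset V} {L : ℕ} {p : List V}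
    (hp : IsPathIn G S p) (hL : p.length = L + 1)
    (hmax : ¬ ∃ l', IsPathIn G S l' ∧ l'.length = L + 2)
    (hdeg : ∀ x ∈ S, L + 1 ≤ 2 * innerDegree G S x) :
    ∀ w ∈ p, ∀ z ∈ S, z ∉ p → ¬ G.Adj w z := by
  obtain ⟨i, hiL, h1, h2⟩ : ∃ i, ∃ hi : i < L, G.Adj p[0] p[i + 1] ∧ G.Adj p[L] p[i] := by
    have hA := innerDegree_head_le hp hL hmax
    have hB : innerDegree G S p[L] ≤ ∑ i ∈ range L, if G.Adj p[L] (p.getD i p[0])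
        then 1 else 0 := by
      have hr := hp.reverse
      have hrL : p.reverse.length = L + 1 := by simpa using hL
      have key := innerDegree_head_le hr hrL hmax
      rw [← sum_range_reflect]
      have e0 : p.reverse[0] = p[L] := by simp [List.getElem_reverse, hL]
      rw [e0] at key
      refine key.trans (le_of_eq (sum_congr rfl fun i hi => ?_))
      rw [mem_range] at hi
      have e1 : p.reverse.getD (i + 1) p[L] = p[L - 1 - i] := by
        rw [List.getD_eq_getElem _ _ (by simp; omega), List.getElem_reverse]
        congr 1
        omega
      have e2 : p.getD (L - 1 - i) p[0] = p[L - 1 - i] := List.getD_eq_getElem _ _ (by omega)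
      rw [e1, e2]
    by_contra hcon
    push Not at hcon
    have hsum : ∑ i ∈ range L, ((if G.Adj p[0] (p.getD (i + 1) p[0]) then 1 else 0)
        + (if G.Adj p[L] (p.getD i p[0]) then 1 else 0)) ≤ ∑ i ∈ range L, 1 := by
      refine sum_le_sum fun i hi => ?_
      rw [mem_range] at hi
      rw [List.getD_eq_getElem _ _ (by omega), List.getD_eq_getElem _ _ (by omega)]
      have := hcon i hi
      split_ifs <;> simp_all
    rw [sum_add_distrib] at hsum
    simp only [sum_const, card_range, smul_eq_mul, mul_one] at hsum
    have d1 := hdeg p[0] (hp.2.2 _ (List.getElem_mem _))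
    have d2 := hdeg p[L] (hp.2.2 _ (List.getElem_mem _))
    omega
  obtain ⟨hnd, hch, hS⟩ := hp
  have hperm : (p.take (i + 1) ++ (p.drop (i + 1)).reverse).Perm p := by
    conv_rhs => rw [← List.take_append_drop (i + 1) p]
    exact List.Perm.append_left _ (List.reverse_perm _)
  have hq : IsPathIn G S (p.take (i + 1) ++ (p.drop (i + 1)).reverse) := by
    refine ⟨hperm.nodup_iff.2 hnd, ?_, fun x hx => hS x (hperm.mem_iff.1 hx)⟩
    rw [List.isChain_append, List.isChain_reverse]
    refine ⟨hch.take _, (hch.drop _).imp fun _ _ h => h.symm, fun a ha b hb => ?_⟩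
    rw [Option.mem_def] at ha hb
    rw [List.head?_reverse, List.getLast?_drop, if_neg (by omega), List.getLast?_eq_getElem?, hL,
      Nat.add_sub_cancel, List.getElem?_eq_getElem (by omega)] at hb
    rw [List.getLast?_take, if_neg (by omega), Nat.add_sub_cancel,
      List.getElem?_eq_getElem (by omega)] at ha
    simp only [Option.some_or, Option.some.injEq] at ha hb
    subst ha hb
    exact h2.symm
  have hcl := closed_of_cycle hq (by rw [hperm.length_eq, hL]) (fun a ha b hb => by
    rw [Option.mem_def] at ha hb
    rw [List.getLast?_append, List.getLast?_reverse, List.head?_drop,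
      List.getElem?_eq_getElem (by omega)] at ha
    rw [List.head?_append, List.head?_take, if_neg (by omega), List.head?_eq_getElem?,
      List.getElem?_eq_getElem (by omega)] at hb
    simp only [Option.some_or, Option.some.injEq] at ha hb
    subst ha hb
    exact h1.symm) hmax
  exact fun w hw z hz hzp => hcl w (hperm.mem_iff.2 hw) z hz fun h => hzp (hperm.mem_iff.1 h)

/-- **Erdős–Gallai**: a graph on `S` with more than `m * #S / 2` edges contains a path with `m + 1`
edges. -/
theorem exists_isPathIn_of_volume {m : ℕ} (S : Finset V) (h : m * #S < volume G S) :
    ∃ l, IsPathIn G S l ∧ l.length = m + 2 := by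
  induction S using Finset.strongInduction with
  | H S ih =>
    by_cases hS : ∃ x ∈ S, 2 * innerDegree G S x ≤ m
    · obtain ⟨x, hx, hd⟩ := hS
      have h1 := volume_le_sdiff (G := G) (singleton_subset_iff.2 hx)
      rw [sum_singleton, sdiff_singleton_eq_erase] at h1
      have h2 : #(S.erase x) + 1 = #S := card_erase_add_one hx
      obtain ⟨l, hl, h3⟩ := ih (S.erase x) (erase_ssubset hx) (by
        rw [← h2, mul_add] at h; omega)
      exact ⟨l, hl.mono (erase_subset _ _), h3⟩
    · push Not at hS
      by_contra hno
      have hex : ∃ t, ¬ ∃ l, IsPathIn G S l ∧ l.length = t := ⟨_, hno⟩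
      obtain ⟨t, ht, htmin⟩ : ∃ t, (¬ ∃ l, IsPathIn G S l ∧ l.length = t) ∧
          ∀ t' < t, ∃ l, IsPathIn G S l ∧ l.length = t' := by
        classical
        exact ⟨Nat.find hex, Nat.find_spec hex, fun t' h' => not_not.1 (Nat.find_min hex h')⟩
      have htm : t ≤ m + 2 := by
        by_contra hlt
        exact hno (htmin _ (by omega))
      obtain ⟨x, hx⟩ : S.Nonempty := by
        by_contra hne
        rw [not_nonempty_iff_eq_empty] at hne
        simp [hne, volume] at h
      obtain ⟨L, rfl⟩ : ∃ L, t = L + 2 := by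
        refine ⟨t - 2, ?_⟩
        have h0 : t ≠ 0 := by
          rintro rfl
          exact ht ⟨[], ⟨List.nodup_nil, List.isChain_nil, by simp⟩, rfl⟩
        have h1 : t ≠ 1 := by
          rintro rfl
          exact ht ⟨[x], ⟨List.nodup_singleton x, List.isChain_singleton x, by simpa⟩, rfl⟩
        omega
      obtain ⟨p, hp, hpL⟩ := htmin (L + 1) (by omega)
      have hcl := closed_of_maximal hp hpL ht fun x hx => by
        have := hS x hx
        omega
      have hpS : p.toFinset ⊆ S := fun y hy => hp.2.2 y (List.mem_toFinset.1 hy)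
      have hcard : #p.toFinset = L + 1 := by rw [List.toFinset_card_of_nodup hp.1, hpL]
      have h1 := volume_eq_sdiff_of_closed (G := G) hpS fun w hw z hz => by
        rw [Finset.mem_sdiff, List.mem_toFinset] at hz
        exact hcl w (List.mem_toFinset.1 hw) z hz.1 hz.2
      have h2 := volume_le_card_mul (G := G) p.toFinset
      rw [hcard, Nat.add_sub_cancel] at h2
      have h3 : #(S \ p.toFinset) + (L + 1) = #S := by
        rw [← hcard]; exact card_sdiff_add_card_eq_card hpS
      have h4 : (L + 1) * L ≤ (L + 1) * m := Nat.mul_le_mul_left _ (by omega)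
      obtain ⟨l, hl, h5⟩ := ih (S \ p.toFinset) (sdiff_ssubset hpS (by
        rw [← card_pos, hcard]; omega)) (by
          rw [← h3, mul_add] at h
          have : m * (L + 1) = (L + 1) * m := mul_comm _ _
          omega)
      exact hno ⟨l, hl.mono sdiff_subset, h5⟩

end Volume
/-! ### Colours along a path and greedy extension through typical vertices -/

section Counting

variable {V : Type*} (c : Sym2 V → Fin 3)

/-- The number of edges of colour `i` on the path whose vertices are listed by `l`. -/
def colorCnt (i : Fin 3) : List V → ℕ
  | x :: y :: l => (if c s(x, y) = i then 1 else 0) + colorCnt i (y :: l)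
  | _ => 0

/-- There is a path with `k` edges of each of the three colours. -/
def HasBalancedPath (k : ℕ) : Prop :=
  ∃ l : List V, l.Nodup ∧ ∀ i, colorCnt c i l = k

variable {c}

@[simp] lemma colorCnt_nil (i : Fin 3) : colorCnt c i [] = 0 := rfl

@[simp] lemma colorCnt_singleton (i : Fin 3) (x : V) : colorCnt c i [x] = 0 := rfl

@[simp] lemma colorCnt_cons_cons (i : Fin 3) (x y : V) (l : List V) :
    colorCnt c i (x :: y :: l) = (if c s(x, y) = i then 1 else 0) + colorCnt c i (y :: l) := rfl

lemma colorCnt_reverse_append (i : Fin 3) (x y : V) (l m : List V) :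
    colorCnt c i ((x :: l).reverse ++ y :: m)
      = colorCnt c i (x :: l) + (if c s(x, y) = i then 1 else 0) + colorCnt c i (y :: m) := by
  induction l generalizing x y m with
  | nil => simp
  | cons z l ih =>
    have h : (x :: z :: l).reverse ++ y :: m = (z :: l).reverse ++ x :: y :: m := by simp
    rw [h, ih, colorCnt_cons_cons, colorCnt_cons_cons, Sym2.eq_swap (a := x) (b := z)]
    ring

lemma colorCnt_reverse (i : Fin 3) (l : List V) : colorCnt c i l.reverse = colorCnt c i l := by
  match l with
  | [] => rfl
  | [x] => rfl
  | x :: y :: l =>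
    have h : (x :: y :: l).reverse = (y :: l).reverse ++ x :: [] := by simp
    rw [h, colorCnt_reverse_append, colorCnt_cons_cons, Sym2.eq_swap (a := x) (b := y)]
    simp [add_comm]

/-- The colours `α`, `β`, `γ` are the three colours in some order. -/
def AreColors (α β γ : Fin 3) : Prop := α ≠ β ∧ β ≠ γ ∧ α ≠ γ

lemma AreColors.swap₁₂ {α β γ : Fin 3} (h : AreColors α β γ) : AreColors β α γ :=
  ⟨h.1.symm, h.2.2, h.2.1⟩

lemma AreColors.swap₂₃ {α β γ : Fin 3} (h : AreColors α β γ) : AreColors α γ β :=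
  ⟨h.2.2, h.2.1.symm, h.1⟩

lemma AreColors.swap₁₃ {α β γ : Fin 3} (h : AreColors α β γ) : AreColors γ β α :=
  ⟨h.2.1.symm, h.1.symm, h.2.2.symm⟩

lemma AreColors.eq_or {α β γ : Fin 3} (h : AreColors α β γ) (i : Fin 3) :
    i = α ∨ i = β ∨ i = γ := by
  unfold AreColors at h
  omega

lemma colorCnt_add_add {α β γ : Fin 3} (h : AreColors α β γ) (x : V) (l : List V) :
    colorCnt c α (x :: l) + colorCnt c β (x :: l) + colorCnt c γ (x :: l) = l.length := by
  induction l generalizing x with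
  | nil => simp
  | cons y l ih =>
    have h1 := ih y
    obtain ⟨h12, h23, h13⟩ := h
    rcases AreColors.eq_or ⟨h12, h23, h13⟩ (c s(x, y)) with h | h | h <;>
      simp [h, h12, h23, h13, h12.symm, h23.symm, h13.symm] <;> omega

lemma HasBalancedPath.of_counts {α β γ : Fin 3} (h : AreColors α β γ) {k : ℕ} {x : V} {l : List V}
    (hnd : (x :: l).Nodup) (hlen : l.length = 3 * k) (hα : colorCnt c α (x :: l) = k)
    (hβ : colorCnt c β (x :: l) = k) : HasBalancedPath c k := by
  refine ⟨x :: l, hnd, fun i => ?_⟩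
  have := colorCnt_add_add (c := c) h x l
  rcases h.eq_or i with rfl | rfl | rfl <;> omega

variable (c) in
/-- The graph formed by the edges of colour `i`. -/
def colorGraph (i : Fin 3) : SimpleGraph V where
  Adj x y := x ≠ y ∧ c s(x, y) = i
  symm := ⟨fun x y h => ⟨h.1.symm, by rw [Sym2.eq_swap]; exact h.2⟩⟩
  loopless := ⟨fun _ h => h.1 rfl⟩

instance [DecidableEq V] (i : Fin 3) : DecidableRel (colorGraph c i).Adj :=
  fun x y => inferInstanceAs (Decidable (x ≠ y ∧ c s(x, y) = i))

lemma colorGraph_adj {i : Fin 3} {x y : V} : (colorGraph c i).Adj x y ↔ x ≠ y ∧ c s(x, y) = i :=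
  Iff.rfl

lemma colorCnt_of_isPathIn {i : Fin 3} {S : Finset V} {l : List V}
    (hl : IsPathIn (colorGraph c i) S l) (j : Fin 3) :
    colorCnt c j l = if j = i then l.length - 1 else 0 := by
  obtain ⟨-, hch, -⟩ := hl
  induction l with
  | nil => simp
  | cons x l ih =>
    match l with
    | [] => simp
    | y :: l =>
      rw [List.isChain_cons_cons] at hch
      rw [colorCnt_cons_cons, ih hch.2, hch.1.2]
      rcases eq_or_ne j i with rfl | h
      · simp [add_comm]
      · simp [h, h.symm]

end Counting

section Greedy

variable {V : Type*} [Fintype V] [DecidableEq V] {c : Sym2 V → Fin 3}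

variable (c) in
/-- The neighbours of `x` along edges of colour `i`. -/
def colorNbrs (i : Fin 3) (x : V) : Finset V := {y | (colorGraph c i).Adj x y}

lemma mem_colorNbrs {i : Fin 3} {x y : V} : y ∈ colorNbrs c i x ↔ x ≠ y ∧ c s(x, y) = i := by
  simp [colorNbrs, colorGraph_adj]

variable (c) in
/-- The vertices of `T` are *typical* with respect to a set `B` of rare colours: few vertices lie
outside `T`, and few edges at a vertex of `T` have a colour in `B`. Both numbers together are less
than `t` even after adding `M`, which is to bound the lengths of the paths under construction. -/
def Typical (B : Finset (Fin 3)) (T : Finset V) (t M : ℕ) : Prop :=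
  ∀ x ∈ T, #Tᶜ + #{y | c s(x, y) ∈ B} + M < t

variable {B : Finset (Fin 3)} {T : Finset V} {t M : ℕ}

lemma Typical.exists_mem (hT : Typical c B T t M) {x : V} (hx : x ∈ T) {N : Finset V} (hN : t ≤ #N)
    {l : List V} (hl : l.length ≤ M) : ∃ y ∈ N, y ∈ T ∧ y ∉ l ∧ c s(y, x) ∉ B := by
  by_contra! hcon
  have hsub : N ⊆ Tᶜ ∪ ({y | c s(x, y) ∈ B} : Finset V) ∪ l.toFinset := by
    intro y hy
    by_contra hy'
    simp only [mem_union, mem_compl, mem_filter, mem_univ, true_and, List.mem_toFinset,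
      not_or, not_not] at hy'
    have := hcon y hy hy'.1.1 hy'.2
    rw [Sym2.eq_swap] at this
    exact hy'.1.2 this
  have h1 := card_le_card hsub
  have h2 := card_union_le (Tᶜ ∪ ({y | c s(x, y) ∈ B} : Finset V)) l.toFinset
  have h3 := card_union_le Tᶜ ({y | c s(x, y) ∈ B} : Finset V)
  have h4 := l.toFinset_card_le
  have := hT x hx
  omega

lemma Typical.notMem (hT : Typical c B T t M) {i : Fin 3} (hi : i ∈ B) {a : V}
    (ha : t ≤ #(colorNbrs c i a)) : a ∉ T := by
  intro haT
  have h1 : colorNbrs c i a ⊆ ({y | c s(a, y) ∈ B} : Finset V) := fun y hy => by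
    rw [mem_colorNbrs] at hy
    simp [hy.2, hi]
  have := hT a haT
  have := card_le_card h1
  omega

/-- From a typical vertex `x` go on to `y`, `a`, `z`, where `a` is a vertex of large degree in
colour `i`, the edges `ya` and `az` have colour `i`, and the edge `xy` does not have a rare
colour. -/
lemma Typical.exists_cherry (hT : Typical c B T t M) {i : Fin 3} {x a : V}
    {l : List V} (hx : x ∈ T) (ha : t ≤ #(colorNbrs c i a)) (hal : a ∉ x :: l)
    (hnd : (x :: l).Nodup) (hl : l.length + 3 ≤ M) :
    ∃ y z, y ∈ T ∧ z ∈ T ∧ (z :: a :: y :: x :: l).Nodup ∧ c s(y, x) ∉ B ∧ c s(a, y) = i ∧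
      c s(z, a) = i := by
  obtain ⟨y, hy, hyT, hyl, hyx⟩ := hT.exists_mem hx ha (l := x :: l) (by simp; omega)
  obtain ⟨z, hz, hzT, hzl, -⟩ := hT.exists_mem hx ha (l := y :: x :: l) (by simp; omega)
  rw [mem_colorNbrs] at hy hz
  refine ⟨y, z, hyT, hzT, ?_, hyx, hy.2, by rw [Sym2.eq_swap]; exact hz.2⟩
  have hza := hz.1
  have hya := hy.1
  simp only [List.nodup_cons, List.mem_cons, not_or] at *
  tauto

lemma Typical.exists_cherries (hT : Typical c B T t M) {i : Fin 3} (hi : i ∈ B) {x : V}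
    {l : List V} (hx : x ∈ T) (A : Finset V) (hA : ∀ a ∈ A, t ≤ #(colorNbrs c i a) ∧ a ∉ x :: l)
    (hnd : (x :: l).Nodup) (hl : l.length + 3 * #A ≤ M) :
    ∃ x' l', x' ∈ T ∧ (x' :: l').Nodup ∧ l'.length = l.length + 3 * #A ∧
      colorCnt c i (x' :: l') = colorCnt c i (x :: l) + 2 * #A ∧
      (∀ j ∈ B, j ≠ i → colorCnt c j (x' :: l') = colorCnt c j (x :: l)) ∧
      (∀ y ∈ x' :: l', y ∈ x :: l ∨ y ∈ A ∨ y ∈ T) ∧ (x :: l) <:+ (x' :: l') := by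
  induction A using Finset.induction_on with
  | empty => exact ⟨x, l, hx, hnd, by simp, by simp, by simp, fun y hy => .inl hy, List.suffix_rfl⟩
  | insert a A haA ih =>
    rw [card_insert_of_notMem haA] at hl ⊢
    obtain ⟨x', l', hx', hnd', hlen, hi', hj', hmem, hsuf⟩ :=
      ih (fun b hb => hA b (mem_insert_of_mem hb)) (by omega)
    obtain ⟨ha, hal⟩ := hA a (mem_insert_self _ _)
    have hal' : a ∉ x' :: l' := fun h => by
      rcases hmem a h with h | h | h
      exacts [hal h, haA h, hT.notMem hi ha h]
    obtain ⟨y, z, hy, hz, hnd2, hyx, hay, hza⟩ :=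
      hT.exists_cherry hx' ha hal' hnd' (by omega)
    refine ⟨z, a :: y :: x' :: l', hz, hnd2, by simp; omega, ?_, fun j hj hji => ?_, ?_, ?_⟩
    · have : c s(y, x') ≠ i := fun h => hyx (h ▸ hi)
      simp only [colorCnt_cons_cons, hay, hza, this, hi', if_true, if_false]
      ring
    · have : c s(y, x') ≠ j := fun h => hyx (h ▸ hj)
      simp only [colorCnt_cons_cons, hay, hza, this, hji.symm, hj' j hj hji, if_false]
      ring
    · intro w hw
      simp only [List.mem_cons] at hw hmem
      rcases hw with rfl | rfl | rfl | hw
      · exact .inr (.inr hz)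
      · exact .inr (.inl (mem_insert_self _ _))
      · exact .inr (.inr hy)
      · rcases hmem w hw with h | h | h
        exacts [.inl (List.mem_cons.2 h), .inr (.inl (mem_insert_of_mem h)), .inr (.inr h)]
    · exact hsuf.trans ⟨[z, a, y], rfl⟩

/-- From a typical vertex of a large set `N` go on inside `N` along `j` edges without rare
colours. -/
lemma Typical.exists_steps (hT : Typical c B T t M) {x : V} {l : List V} (hx : x ∈ T)
    {N : Finset V} (hxN : x ∈ N) (hN : t ≤ #N) (hnd : (x :: l).Nodup) (j : ℕ)
    (hl : l.length + j ≤ M) :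
    ∃ x' l', x' ∈ T ∧ x' ∈ N ∧ (x' :: l').Nodup ∧ l'.length = l.length + j ∧
      (∀ i ∈ B, colorCnt c i (x' :: l') = colorCnt c i (x :: l)) ∧
      (∀ y ∈ x' :: l', y ∈ x :: l ∨ y ∈ N ∧ y ∈ T) := by
  induction j with
  | zero => exact ⟨x, l, hx, hxN, hnd, by simp, by simp, fun y hy => .inl hy⟩
  | succ j ih =>
    obtain ⟨x', l', hx', -, hnd', hlen, hi', hmem⟩ := ih (by omega)
    obtain ⟨y, hyN, hyT, hyl, hyx⟩ := hT.exists_mem hx' hN (l := x' :: l') (by simp; omega)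
    refine ⟨y, x' :: l', hyT, hyN, List.nodup_cons.2 ⟨hyl, hnd'⟩, by simp; omega,
      fun i hi => ?_, fun w hw => ?_⟩
    · have : c s(y, x') ≠ i := fun h => hyx (h ▸ hi)
      simp [this, hi' i hi]
    · rcases List.mem_cons.1 hw with rfl | hw
      exacts [.inr ⟨hyN, hyT⟩, hmem w hw]

end Greedy

/-! ### Rich sets -/

section MinDegree

variable {V : Type*} [DecidableEq V]

/-- A path may start at any vertex of a graph of large minimum degree and avoid a small set. -/
lemma exists_isPathIn_from {G : SimpleGraph V} [DecidableRel G.Adj] {Q : Finset V} {d : ℕ}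
    (hQ : ∀ x ∈ Q, d < innerDegree G Q x) (j : ℕ) {x : V} (hx : x ∈ Q) (F : Finset V)
    (hd : #F + j ≤ d) :
    ∃ m, IsPathIn G Q (x :: m) ∧ m.length = j ∧ ∀ y ∈ m, y ∉ F := by
  induction j generalizing x F with
  | zero => exact ⟨[], ⟨List.nodup_singleton x, List.isChain_singleton x, by simpa⟩, rfl, by simp⟩
  | succ j ih =>
    obtain ⟨y, hy, hyF⟩ : ∃ y ∈ ({y ∈ Q | G.Adj x y} : Finset V), y ∉ F := by
      refine exists_mem_notMem_of_card_lt_card ?_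
      have := hQ x hx
      unfold innerDegree at this
      omega
    rw [mem_filter] at hy
    obtain ⟨m, ⟨hnd, hch, hmQ⟩, hm, hmF⟩ := ih hy.1 (insert x F) (by
      have := card_insert_le x F
      omega)
    have hxm : x ∉ y :: m := by
      rw [List.mem_cons, not_or]
      exact ⟨hy.2.ne, fun h => hmF x h (mem_insert_self _ _)⟩
    refine ⟨y :: m, ⟨List.nodup_cons.2 ⟨hxm, hnd⟩, List.isChain_cons_cons.2 ⟨hy.2, hch⟩, ?_⟩,
      by simp [hm], ?_⟩
    · exact fun z hz => (List.mem_cons.1 hz).elim (fun h => h ▸ hx) (hmQ z)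
    · exact fun z hz => (List.mem_cons.1 hz).elim (fun h => h ▸ hyF)
        fun h h' => hmF z h (mem_insert_of_mem h')

lemma card_lt_of_minDegree {G : SimpleGraph V} [DecidableRel G.Adj] {Q : Finset V} {d : ℕ}
    (hQ : ∀ x ∈ Q, d < innerDegree G Q x) (hne : Q.Nonempty) : d < #Q := by
  obtain ⟨x, hx⟩ := hne
  exact (hQ x hx).trans_le (card_le_card (filter_subset _ _))

end MinDegree

section Extension

variable {V : Type*} [DecidableEq V] {c : Sym2 V → Fin 3}

variable (c) in
/-- `Q` is nonempty, and each of its vertices sends more than `d` edges of colour `i` to `Q`. -/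
def IsRich (i : Fin 3) (Q : Finset V) (d : ℕ) : Prop :=
  Q.Nonempty ∧ ∀ x ∈ Q, d < innerDegree (colorGraph c i) Q x

lemma IsRich.card_lt {i : Fin 3} {Q : Finset V} {d : ℕ} (h : IsRich c i Q d) : d < #Q :=
  card_lt_of_minDegree h.2 h.1

/-- From a vertex of a rich set go on inside that set along `j` edges of its colour. -/
lemma IsRich.exists_extension {i : Fin 3} {Q : Finset V} {d : ℕ} (hQ : IsRich c i Q d) {x : V}
    {l : List V} (hx : x ∈ Q) (hnd : (x :: l).Nodup) (j : ℕ) (hd : l.length + j ≤ d) :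
    ∃ x' l', x' ∈ Q ∧ (x' :: l').Nodup ∧ l'.length = l.length + j ∧
      (∀ i', colorCnt c i' (x' :: l') = colorCnt c i' (x :: l) + if i' = i then j else 0) ∧
      (∀ y ∈ x' :: l', y ∈ x :: l ∨ y ∈ Q) ∧ (x :: l) <:+ (x' :: l') := by
  obtain ⟨m, hm, hmj, hml⟩ := exists_isPathIn_from hQ.2 j hx l.toFinset (by
    have := l.toFinset_card_le
    omega)
  match m, hm, hmj, hml with
  | [], hm, hmj, hml =>
    simp only [List.length_nil] at hmj
    subst hmj
    exact ⟨x, l, hx, hnd, by simp, by simp, fun y hy => .inl hy, List.suffix_rfl⟩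
  | y :: m, hm, hmj, hml =>
    obtain ⟨x', l', he⟩ : ∃ x' l', (y :: m).reverse ++ x :: l = x' :: l' :=
      List.exists_cons_of_ne_nil (by simp)
    have hnd' : ((y :: m).reverse ++ x :: l).Nodup := by
      rw [List.nodup_append]
      refine ⟨List.nodup_reverse.2 (List.nodup_cons.1 hm.1).2, hnd, fun a ha b hb hab => ?_⟩
      subst hab
      rw [List.mem_reverse] at ha
      rcases List.mem_cons.1 hb with rfl | hb
      · exact (List.nodup_cons.1 hm.1).1 ha
      · exact hml a ha (List.mem_toFinset.2 hb)
    have hmem : ∀ z ∈ x' :: l', z ∈ x :: l ∨ z ∈ Q := fun z hz => by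
      rw [← he, List.mem_append, List.mem_reverse] at hz
      exact hz.symm.imp_right fun h => hm.2.2 z (List.mem_cons_of_mem _ h)
    refine ⟨x', l', ?_, he ▸ hnd', ?_, fun i' => ?_, hmem, he ▸ List.suffix_append _ _⟩
    · have h1 : x' ∈ (y :: m).reverse := by
        have : ((y :: m).reverse ++ x :: l).head? = some x' := by rw [he]; rfl
        rw [List.head?_append, List.head?_reverse, List.getLast?_cons, Option.some_or] at this
        rw [List.mem_reverse]
        exact List.mem_of_getLast? (by rw [List.getLast?_cons, this])
      exact hm.2.2 _ (List.mem_cons_of_mem _ (List.mem_reverse.1 h1))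
    · have := congrArg List.length he
      simp at this hmj
      omega
    · have h1 := colorCnt_of_isPathIn hm i'
      rw [colorCnt_cons_cons, Sym2.eq_swap] at h1
      rw [← he, colorCnt_reverse_append]
      split_ifs at h1 ⊢ <;> simp_all <;> omega

/-- A path with the right number of `β`-edges and not too many `α`- and `γ`-edges whose ends lie in
an `α`-rich and a `γ`-rich set can be prolonged to a balanced path. -/
lemma HasBalancedPath.of_rich_ends {α β γ : Fin 3} (hc : AreColors α β γ) {k d : ℕ}
    {A C : Finset V} (hA : IsRich c α A d) (hC : IsRich c γ C d) (hd : 3 * k ≤ d)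
    {p : List V} (hnd : p.Nodup) {w z : V} (hw : w ∈ p.head?) (hz : z ∈ p.getLast?) (hwA : w ∈ A)
    (hzC : z ∈ C) (hα : colorCnt c α p ≤ k) (hβ : colorCnt c β p = k) (hγ : colorCnt c γ p ≤ k) :
    HasBalancedPath c k := by
  obtain ⟨l, rfl⟩ : ∃ l, p = w :: l := List.head?_eq_some_iff.1 hw
  have hlen := colorCnt_add_add (c := c) hc w l
  obtain ⟨w', l', -, hnd', hlen', hcnt', -, hsuf⟩ :=
    hA.exists_extension hwA hnd (k - colorCnt c α (w :: l)) (by omega)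
  have hz' : z ∈ (w' :: l').getLast? := by
    obtain ⟨u, hu⟩ := hsuf
    rw [← hu, List.getLast?_append]
    rw [Option.mem_def] at hz
    simp [hz]
  rw [← List.head?_reverse] at hz'
  obtain ⟨m, hm⟩ : ∃ m, (w' :: l').reverse = z :: m := List.head?_eq_some_iff.1 hz'
  have hcm : ∀ i, colorCnt c i (z :: m) = colorCnt c i (w' :: l') := fun i => by
    rw [← hm, colorCnt_reverse]
  have hlm := congrArg List.length hm
  simp only [List.length_reverse, List.length_cons] at hlm
  obtain ⟨z', m', -, hnd'', -, hcnt'', -, -⟩ :=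
    hC.exists_extension hzC (l := m) (hm ▸ List.nodup_reverse.2 hnd')
      (k - colorCnt c γ (w :: l)) (by omega)
  refine ⟨z' :: m', hnd'', fun i => ?_⟩
  rw [hcnt'', hcm, hcnt']
  obtain ⟨h12, h23, h13⟩ := hc
  rcases AreColors.eq_or ⟨h12, h23, h13⟩ i with rfl | rfl | rfl <;>
    simp only [h23, h13, h12.symm, h13.symm, if_true, if_false] <;> omega

end Extension

/-! ### Three rich colours -/

section ThreeRich

variable {V : Type*} [DecidableEq V] {c : Sym2 V → Fin 3} {α β γ : Fin 3} {k d : ℕ}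
  {A Q C : Finset V}

/-- Linking a segment of a `β`-path to both other rich sets must not produce exactly `k` edges of
colour `β`, for then the ends could be prolonged. -/
lemma segment_count_ne (hc : AreColors α β γ) (hk : 2 ≤ k) (hA : IsRich c α A d)
    (hC : IsRich c γ C d) (hd : 3 * k ≤ d) (hno : ¬ HasBalancedPath c k)
    {q : List V} (hq : IsPathIn (colorGraph c β) Q q) {w z : V} (hw : w ∈ A) (hz : z ∈ C)
    (hwq : w ∉ q) (hzq : z ∉ q) (hwz : w ≠ z) {i j : ℕ} (hij : i ≤ j) (hj : j < q.length) :
    (if c s(w, q[i]) = β then 1 else 0) + (j - i) + (if c s(z, q[j]) = β then 1 else 0) ≠ k := by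
  intro hcon
  set s := (q.take (j + 1)).drop i with hs
  have hsub : s.Sublist q := (List.drop_sublist _ _).trans (List.take_sublist _ _)
  have hsp : IsPathIn (colorGraph c β) Q s :=
    ⟨hq.1.sublist hsub, (hq.2.1.take _).drop _, fun x hx => hq.2.2 x (hsub.subset hx)⟩
  have hlen : s.length = j + 1 - i := by simp [hs]; omega
  have hhead : s.head? = some q[i] := by
    rw [hs, List.head?_drop, List.getElem?_take_of_lt (by omega), List.getElem?_eq_getElem]
  have hlast : s.reverse.head? = some q[j] := by
    rw [List.head?_reverse, hs, List.getLast?_drop, if_neg (by simp; omega), List.getLast?_take]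
    simp [List.getElem?_eq_getElem hj]
  obtain ⟨s₁, hs₁⟩ := List.head?_eq_some_iff.1 hhead
  obtain ⟨s₂, hs₂⟩ := List.head?_eq_some_iff.1 hlast
  have hcnt : ∀ i', colorCnt c i' (w :: (z :: s.reverse).reverse) =
      (if c s(w, q[i]) = i' then 1 else 0) + (if i' = β then j - i else 0)
        + (if c s(z, q[j]) = i' then 1 else 0) := fun i' => by
    have h1 : (z :: s.reverse).reverse = q[i] :: (s₁ ++ [z]) := by simp [hs₁]
    have h2 := colorCnt_of_isPathIn hsp i'
    rw [h1, colorCnt_cons_cons, ← h1, colorCnt_reverse, hs₂, colorCnt_cons_cons, ← hs₂,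
      colorCnt_reverse, h2, hlen]
    split_ifs <;> omega
  obtain ⟨h12, h23, h13⟩ := hc
  refine hno (HasBalancedPath.of_rich_ends ⟨h12, h23, h13⟩ hA hC hd (w := w) (z := z)
    (p := w :: (z :: s.reverse).reverse) ?_ (by simp) ?_ hw hz ?_ ?_ ?_)
  · have h1 : w ∉ s := fun h => hwq (hsub.subset h)
    have h2 : z ∉ s := fun h => hzq (hsub.subset h)
    rw [List.nodup_cons, List.nodup_reverse, List.nodup_cons, List.nodup_reverse]
    simp [h1, h2, hwz, hsp.1]
  · rw [← List.reverse_reverse (w :: _), List.getLast?_reverse]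
    simp
  · rw [hcnt, if_neg h12]
    split_ifs <;> omega
  · rw [hcnt, if_pos rfl]
    exact hcon
  · rw [hcnt, if_neg h23.symm]
    split_ifs <;> omega

lemma xor_of_segment_counts {P₀ P₁ R₀ R₁ R₂ : Prop} [Decidable P₀] [Decidable P₁] [Decidable R₀]
    [Decidable R₁] [Decidable R₂] {k : ℕ} (hk : 2 ≤ k)
    (h1 : (if P₀ then 1 else 0) + (k - 0) + (if R₀ then 1 else 0) ≠ k)
    (h2 : (if P₀ then 1 else 0) + (k - 1 - 0) + (if R₁ then 1 else 0) ≠ k)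
    (h3 : (if P₁ then 1 else 0) + (k - 1) + (if R₀ then 1 else 0) ≠ k)
    (h4 : (if P₀ then 1 else 0) + (k - 2 - 0) + (if R₂ then 1 else 0) ≠ k)
    (h5 : (if P₁ then 1 else 0) + (k - 1 - 1) + (if R₁ then 1 else 0) ≠ k) :
    (P₀ ↔ ¬ P₁) ∧ (P₀ ↔ R₁) := by
  by_cases p0 : P₀ <;> by_cases p1 : P₁ <;> by_cases r0 : R₀ <;> by_cases r1 : R₁ <;>
    simp only [p0, p1, r0, r1, if_true, if_false, not_true_eq_false, not_false_eq_true, iff_self,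
      and_self, iff_true, iff_false] at * <;> omega

/-- If there is no balanced path, then each vertex of the `γ`-rich set sends a `β`-edge to exactly
one end of each `β`-edge in the `β`-rich set, and the choice of that end does not depend on the
vertex. -/
lemma alternation (hc : AreColors α β γ) (hk : 2 ≤ k) (hA : IsRich c α A d)
    (hQ : IsRich c β Q d) (hC : IsRich c γ C d) (hd : 3 * k + 4 ≤ d) (hno : ¬ HasBalancedPath c k)
    {v₀ v₁ z z' : V} (hv₀ : v₀ ∈ Q) (hv₁ : v₁ ∈ Q) (hadj : (colorGraph c β).Adj v₀ v₁)
    (hz : z ∈ C) (hz' : z' ∈ C) (hd₁ : z ≠ v₀) (hd₂ : z ≠ v₁) (hd₃ : z' ≠ v₀) (hd₄ : z' ≠ v₁) :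
    (c s(z, v₀) = β ↔ ¬ c s(z, v₁) = β) ∧ (c s(z, v₀) = β ↔ c s(z', v₀) = β) := by
  obtain ⟨m, hm, hml, hmF⟩ := exists_isPathIn_from hQ.2 (k - 1) hv₁ {v₀, z, z'} (by
    have := card_le_three (a := v₀) (b := z) (c := z')
    omega)
  have hv₀m : v₀ ∉ v₁ :: m := by
    rw [List.mem_cons, not_or]
    exact ⟨hadj.ne, fun h => hmF _ h (by simp)⟩
  have hq : IsPathIn (colorGraph c β) Q (v₀ :: v₁ :: m) :=
    ⟨List.nodup_cons.2 ⟨hv₀m, hm.1⟩, List.isChain_cons_cons.2 ⟨hadj, hm.2.1⟩, fun x hx =>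
      (List.mem_cons.1 hx).elim (fun h => h ▸ hv₀) (hm.2.2 x)⟩
  have hlen : (v₀ :: v₁ :: m).length = k + 1 := by simp [hml]; omega
  obtain ⟨w, hw, hwF⟩ := exists_mem_notMem_of_card_lt_card
    (s := insert z (insert z' (v₀ :: v₁ :: m).toFinset)) (t := A) (by
    have h1 := card_insert_le z (insert z' (v₀ :: v₁ :: m).toFinset)
    have h2 := card_insert_le z' (v₀ :: v₁ :: m).toFinset
    have h3 := (v₀ :: v₁ :: m).toFinset_card_le
    have h4 := hA.card_lt
    omega)
  simp only [mem_insert, List.mem_toFinset, not_or] at hwF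
  have key : ∀ y ∈ C, w ≠ y → y ∉ v₀ :: v₁ :: m →
      (c s(y, v₀) = β ↔ ¬ c s(y, v₁) = β) ∧
        (c s(y, v₀) = β ↔ c s(w, (v₀ :: v₁ :: m)[k - 1]) = β) := fun y hy hwy hyq => by
    have hseg := fun (i j : ℕ) (hij : i ≤ j) (hj : j < (v₀ :: v₁ :: m).length) =>
      segment_count_ne hc.swap₁₃ hk hC hA (by omega) hno hq hy hw hyq hwF.2.2 hwy.symm hij hj
    exact xor_of_segment_counts hk (hseg 0 k (by omega) (by omega))
      (hseg 0 (k - 1) (by omega) (by omega)) (hseg 1 k (by omega) (by omega))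
      (hseg 0 (k - 2) (by omega) (by omega)) (hseg 1 (k - 1) (by omega) (by omega))
  have hzq : z ∉ v₀ :: v₁ :: m := by
    simp only [List.mem_cons, not_or]
    exact ⟨hd₁, hd₂, fun h => hmF _ h (by simp)⟩
  have hzq' : z' ∉ v₀ :: v₁ :: m := by
    simp only [List.mem_cons, not_or]
    exact ⟨hd₃, hd₄, fun h => hmF _ h (by simp)⟩
  have h1 := key z hz hwF.1 hzq
  have h2 := key z' hz' hwF.2.1 hzq'
  exact ⟨h1.1, h1.2.trans h2.2.symm⟩

theorem HasBalancedPath.of_three_rich (hc : AreColors α β γ) (hk : 2 ≤ k) (hA : IsRich c α A d)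
    (hQ : IsRich c β Q d) (hC : IsRich c γ C d) (hd : 3 * k + 4 ≤ d) : HasBalancedPath c k := by
  by_contra hno
  obtain ⟨v₀, hv₀⟩ := hQ.1
  obtain ⟨m, hm, hml, -⟩ := exists_isPathIn_from hQ.2 1 hv₀ ∅ (by simp; omega)
  obtain ⟨v₁, rfl⟩ := List.length_eq_one_iff.1 hml
  obtain ⟨z₀, hz₀, hz₀F⟩ := exists_mem_notMem_of_card_lt_card (s := {v₀, v₁}) (t := C) (by
    have h1 := card_le_two (a := v₀) (b := v₁)
    have := hC.card_lt
    omega)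
  obtain ⟨m', hm', hml', hmF⟩ := exists_isPathIn_from hC.2 1 hz₀ {v₀, v₁} (by
    have h1 := card_le_two (a := v₀) (b := v₁)
    omega)
  obtain ⟨z₁, rfl⟩ := List.length_eq_one_iff.1 hml'
  have hv₁ : v₁ ∈ Q := hm.2.2 _ (by simp)
  have hz₁ : z₁ ∈ C := hm'.2.2 _ (by simp)
  have hav : (colorGraph c β).Adj v₀ v₁ := (List.isChain_cons_cons.1 hm.2.1).1
  have haz : (colorGraph c γ).Adj z₀ z₁ := (List.isChain_cons_cons.1 hm'.2.1).1
  have hz₁F := hmF z₁ (by simp)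
  simp only [mem_insert, mem_singleton, not_or] at hz₀F hz₁F
  have e0 := alternation hc hk hA hQ hC hd hno hv₀ hv₁ hav hz₀ hz₁ hz₀F.1 hz₀F.2 hz₁F.1 hz₁F.2
  have e1 := alternation hc hk hA hQ hC hd hno hv₁ hv₀ hav.symm hz₀ hz₁ hz₀F.2 hz₀F.1 hz₁F.2 hz₁F.1
  have f0 := alternation hc.swap₂₃ hk hA hC hQ hd hno hz₀ hz₁ haz hv₀ hv₁ (Ne.symm hz₀F.1)
    (Ne.symm hz₁F.1) (Ne.symm hz₀F.2) (Ne.symm hz₁F.2)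
  have f1 := alternation hc.swap₂₃ hk hA hC hQ hd hno hz₀ hz₁ haz hv₁ hv₀ (Ne.symm hz₀F.2)
    (Ne.symm hz₁F.2) (Ne.symm hz₀F.1) (Ne.symm hz₁F.1)
  have g0 := f0.1
  have g1 := f1.1
  rw [Sym2.eq_swap, Sym2.eq_swap (a := v₀) (b := z₁)] at g0
  rw [Sym2.eq_swap, Sym2.eq_swap (a := v₁) (b := z₁)] at g1
  have hβγ : ∀ e, c e = β → ¬ c e = γ := fun e h h' => hc.2.1 (h.symm.trans h')
  -- the end of `v₀v₁` that receives a `β`-edge from `z₀` also receives one from `z₁`, so that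
  -- neither of these two edges has colour `γ`
  by_cases h : c s(z₀, v₀) = β
  · exact hβγ _ h (g0.2 (hβγ _ (e0.2.1 h)))
  · have h' : c s(z₀, v₁) = β := not_not.1 fun h' => h (e0.1.2 h')
    exact hβγ _ h' (g1.2 (hβγ _ (e1.2.1 h')))

end ThreeRich

/-! ### One rare colour -/

section OneRare

variable {V : Type*} [Fintype V] [DecidableEq V] {c : Sym2 V → Fin 3} {α β γ : Fin 3} {k d t : ℕ}
  {A C T : Finset V}

lemma Typical.card_colorNbrs_lt {B : Finset (Fin 3)} {M : ℕ} (hT : Typical c B T t M) {i : Fin 3}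
    (hi : i ∈ B) {x : V} (hx : x ∈ T) : #(colorNbrs c i x) < t :=
  not_le.1 fun h => hT.notMem hi h hx

lemma IsRich.exists_link {i j : Fin 3} (hA : IsRich c i A d) {x : V}
    (hx : #(colorNbrs c j x) < t) {l : List V} (hxl : x ∈ l) (hl : l.length + t ≤ d) :
    ∃ w ∈ A, w ∉ l ∧ c s(w, x) ≠ j := by
  obtain ⟨w, hw, hwF⟩ := exists_mem_notMem_of_card_lt_card (s := colorNbrs c j x ∪ l.toFinset)
    (t := A) (by
      have h1 := card_union_le (colorNbrs c j x) l.toFinset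
      have h2 := l.toFinset_card_le
      have h3 := hA.card_lt
      omega)
  simp only [mem_union, List.mem_toFinset, mem_colorNbrs, not_or, not_and] at hwF
  refine ⟨w, hw, hwF.2, fun h => hwF.1 (fun h' => hwF.2 (h' ▸ hxl)) ?_⟩
  rwa [Sym2.eq_swap]

/-- A path with `k` edges of colour `β` and fewer than `k` other edges can be completed if its
last vertex lies in the `α`-rich set and its first vertex has small degree in `β`. -/
lemma HasBalancedPath.of_rich_last (hc : AreColors α β γ) (hA : IsRich c α A d)
    (hC : IsRich c γ C d) (hd : 3 * k + t + 1 ≤ d) {x w : V} {l : List V}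
    (hnd : (x :: l).Nodup) (hw : w ∈ (x :: l).getLast?) (hwA : w ∈ A)
    (hx : #(colorNbrs c β x) < t) (hβ : colorCnt c β (x :: l) = k) (hl : l.length < 2 * k) :
    HasBalancedPath c k := by
  have hcnt := colorCnt_add_add (c := c) hc x l
  obtain ⟨z, hz, hzl, hzx⟩ := hC.exists_link hx (l := x :: l) (by simp) (by simp; omega)
  refine HasBalancedPath.of_rich_ends hc.swap₁₃ hC hA (by omega) (p := z :: x :: l)
    (List.nodup_cons.2 ⟨hzl, hnd⟩) (w := z) (by simp) (z := w) ?_ hz hwA ?_ ?_ ?_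
  · rwa [List.getLast?_cons_cons]
  · rw [colorCnt_cons_cons]
    split_ifs <;> omega
  · rw [colorCnt_cons_cons, if_neg hzx, hβ, zero_add]
  · rw [colorCnt_cons_cons]
    split_ifs <;> omega

lemma HasBalancedPath.of_rare_path (hc : AreColors α β γ) (hk : 2 ≤ k) (hA : IsRich c α A d)
    (hC : IsRich c γ C d) (hd : 3 * k + t + 1 ≤ d) {S : Finset V}
    (hS : ∀ x ∈ S, #(colorNbrs c β x) < t) {p : List V}
    (hp : IsPathIn (colorGraph c β) S p) (hlen : p.length = k + 1) : HasBalancedPath c k := by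
  obtain ⟨x, l, rfl⟩ := List.exists_cons_of_length_eq_add_one hlen
  obtain ⟨w, hw, hwl, hwx⟩ := hA.exists_link (hS x (hp.2.2 x (by simp))) (l := x :: l) (by simp)
    (by simp at hlen ⊢; omega)
  obtain ⟨y, m, hm⟩ : ∃ y m, (x :: l).reverse = y :: m := List.exists_cons_of_ne_nil (by simp)
  have hr : (w :: x :: l).reverse = y :: (m ++ [w]) := by
    rw [List.reverse_cons, hm, List.cons_append]
  have hml := congrArg List.length hm
  simp only [List.length_reverse, hlen, List.length_cons] at hml
  refine HasBalancedPath.of_rich_last hc hA hC hd (x := y) (l := m ++ [w]) (w := w) ?_ ?_ hw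
    (hS y (hp.2.2 y ?_)) ?_ ?_
  · rw [← hr, List.nodup_reverse]
    exact List.nodup_cons.2 ⟨hwl, hp.1⟩
  · rw [← hr]
    simp
  · rw [← List.mem_reverse, hm]
    simp
  · rw [← hr, colorCnt_reverse, colorCnt_cons_cons, if_neg hwx, colorCnt_of_isPathIn hp, if_pos rfl,
      hlen]
    omega
  · simp
    omega

/-- The even case with many vertices of large `β`-degree: alternate `k / 2` of them with typical
vertices. -/
lemma HasBalancedPath.of_even_hubs (hc : AreColors α β γ) (hk : 2 ≤ k)
    (hT : Typical c {β} T t (3 * k + 3)) (hA : IsRich c α A d)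
    (hC : IsRich c γ C d) (hAT : A ⊆ T) (hd : 3 * k + t + 1 ≤ d) {L : Finset V}
    (hL : ∀ a ∈ L, t ≤ #(colorNbrs c β a)) {h : ℕ} (hh : k = 2 * h) (hLh : h ≤ #L) :
    HasBalancedPath c k := by
  obtain ⟨L', hL', hcard⟩ := exists_subset_card_eq hLh
  obtain ⟨w, hw⟩ := hA.1
  obtain ⟨x, l, hx, hnd, hlen, hcnt, -, -, hsuf⟩ := hT.exists_cherries (mem_singleton_self β)
    (x := w) (l := []) (hAT hw) L' (fun a ha => ⟨hL a (hL' ha), fun h => by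
      rw [List.mem_singleton] at h
      exact hT.notMem (mem_singleton_self β) (hL a (hL' ha)) (h ▸ hAT hw)⟩)
    (List.nodup_singleton w) (by simp; omega)
  refine HasBalancedPath.of_rich_last hc hA hC hd hnd (w := w) ?_ hw
    (hT.card_colorNbrs_lt (mem_singleton_self β) hx) (by simp at hcnt; omega)
    (by simp at hlen; omega)
  obtain ⟨u, hu⟩ := hsuf
  rw [← hu]
  simp

/-- The odd case when some vertex `a` of large `β`-degree sends an edge of another colour to the
`α`-rich set: `a` then contributes a single `β`-edge next to the end of the `β`-part. -/
lemma HasBalancedPath.of_odd_hubs_of_ne (hc : AreColors α β γ) (hk : 2 ≤ k)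
    (hT : Typical c {β} T t (3 * k + 3)) (hA : IsRich c α A d)
    (hC : IsRich c γ C d) (hAT : A ⊆ T) (hd : 3 * k + t + 1 ≤ d) {L : Finset V}
    (hL : ∀ a ∈ L, t ≤ #(colorNbrs c β a)) {h : ℕ} (hh : k = 2 * h + 1) (hLh : h ≤ #L)
    {a u : V} (ha : t ≤ #(colorNbrs c β a)) (haL : a ∉ L) (hu : u ∈ A) (hau : c s(a, u) ≠ β) :
    HasBalancedPath c k := by
  have hβ := mem_singleton_self β
  obtain ⟨L', hL', hcard⟩ := exists_subset_card_eq hLh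
  have hnT : ∀ a ∈ L, a ∉ T := fun a ha => hT.notMem hβ (hL a ha)
  have haT : a ∉ T := hT.notMem hβ ha
  have hau' : a ≠ u := fun h => haT (h ▸ hAT hu)
  obtain ⟨z, hz, hzT, hzl, -⟩ := hT.exists_mem (hAT hu) ha (l := [a, u]) (by simp)
  rw [mem_colorNbrs] at hz
  obtain ⟨x, l, hx, hnd, hlen, hcnt, -, -, hsuf⟩ := hT.exists_cherries hβ
    (x := z) (l := [a, u]) hzT L' (fun b hb => ⟨hL b (hL' hb), fun h => by
      simp only [List.mem_cons, List.not_mem_nil, or_false] at h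
      rcases h with rfl | rfl | rfl
      exacts [hnT _ (hL' hb) hzT, haL (hL' hb), hnT _ (hL' hb) (hAT hu)]⟩)
    (List.nodup_cons.2 ⟨hzl, by simpa⟩) (by simp; omega)
  have hza : c s(z, a) = β := by rw [Sym2.eq_swap]; exact hz.2
  simp [hza, hau] at hcnt hlen
  refine HasBalancedPath.of_rich_last hc hA hC hd hnd (w := u) ?_ hu
    (hT.card_colorNbrs_lt hβ hx) (by omega) (by omega)
  obtain ⟨u', hu'⟩ := hsuf
  rw [← hu']
  simp

/-- The odd case when a vertex `a` of large `β`-degree is joined in colour `β` to the whole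
`α`-rich set: the path ends with an edge from that set to `a`. -/
lemma HasBalancedPath.of_odd_hubs_of_forall (hc : AreColors α β γ) (hk : 2 ≤ k)
    (hT : Typical c {β} T t (3 * k + 3)) (hA : IsRich c α A d)
    (hC : IsRich c γ C d) (hAT : A ⊆ T) (hCT : C ⊆ T) (hd : 3 * k + t + 1 ≤ d) {L : Finset V}
    (hL : ∀ a ∈ L, t ≤ #(colorNbrs c β a)) {h : ℕ} (hh : k = 2 * h + 1) (hLh : h ≤ #L)
    {a : V} (ha : t ≤ #(colorNbrs c β a)) (haL : a ∉ L) (hau : ∀ u ∈ A, c s(a, u) = β) :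
    HasBalancedPath c k := by
  have hβ := mem_singleton_self β
  obtain ⟨L', hL', hcard⟩ := exists_subset_card_eq hLh
  have hnT : ∀ a ∈ L, a ∉ T := fun a ha => hT.notMem hβ (hL a ha)
  have haT : a ∉ T := hT.notMem hβ ha
  obtain ⟨w, hw⟩ := hC.1
  obtain ⟨x, l, hx, hnd, hlen, hcnt, -, hmem, hsuf⟩ := hT.exists_cherries hβ
    (x := w) (l := []) (hCT hw) L' (fun a ha => ⟨hL a (hL' ha), fun h => by
      rw [List.mem_singleton] at h
      exact hnT a (hL' ha) (h ▸ hCT hw)⟩) (List.nodup_singleton w) (by simp; omega)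
  simp at hlen hcnt
  obtain ⟨u, hu, hul, hux⟩ := hA.exists_link (hT.card_colorNbrs_lt hβ hx) (l := x :: l) (by simp)
    (by simp; omega)
  have hsum := colorCnt_add_add (c := c) hc u (x :: l)
  have hβu : colorCnt c β (u :: x :: l) = 2 * h := by
    rw [colorCnt_cons_cons, if_neg hux]
    omega
  simp only [List.length_cons] at hsum
  obtain ⟨u', l', hu', hnd', hlen', hcnt', hmem', hsuf'⟩ := hA.exists_extension hu
    (l := x :: l) (List.nodup_cons.2 ⟨hul, hnd⟩) (k - colorCnt c α (u :: x :: l))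
    (by simp; omega)
  simp only [List.length_cons] at hlen'
  have ha' : a ∉ u' :: l' := fun h => by
    rcases hmem' a h with h | h
    · rcases List.mem_cons.1 h with rfl | h
      · exact haT (hAT hu)
      · rcases hmem a h with h | h | h
        · exact haT ((List.mem_singleton.1 h) ▸ hCT hw)
        · exact haL (hL' h)
        · exact haT h
    · exact haT (hAT h)
  obtain ⟨m, hm⟩ : ∃ m, (a :: u' :: l').reverse = w :: m := by
    refine List.head?_eq_some_iff.1 ?_
    obtain ⟨s₁, hs₁⟩ := hsuf
    obtain ⟨s₂, hs₂⟩ := hsuf'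
    rw [List.head?_reverse, List.getLast?_cons_cons, ← hs₂, ← hs₁, ← List.cons_append,
      ← List.append_assoc, List.getLast?_concat]
  have hml := congrArg List.length hm
  simp only [List.length_reverse, List.length_cons] at hml
  have hcm : ∀ i, colorCnt c i (w :: m) =
      (if β = i then 1 else 0) + (colorCnt c i (u :: x :: l) +
        if i = α then k - colorCnt c α (u :: x :: l) else 0) := fun i => by
    rw [← hm, colorCnt_reverse, colorCnt_cons_cons, hcnt', hau u' hu']
  obtain ⟨w', m', -, hnd'', -, hcnt'', -, -⟩ := hC.exists_extension hw (l := m)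
    (hm ▸ List.nodup_reverse.2 (List.nodup_cons.2 ⟨ha', hnd'⟩))
    (k - colorCnt c γ (u :: x :: l)) (by omega)
  refine ⟨w' :: m', hnd'', fun i => ?_⟩
  rw [hcnt'', hcm]
  obtain ⟨h12, h23, h13⟩ := hc
  rcases AreColors.eq_or ⟨h12, h23, h13⟩ i with rfl | rfl | rfl <;>
    simp only [h23, h13, h12.symm, h13.symm, if_true, if_false] <;> omega

/-- A long path of colour `i` outside `X ∪ Y`, where `X` is small and the vertices of `Y` have small
degree. -/
lemma exists_isPathIn_sdiff {i : Fin 3} {X Y : Finset V} {m p q : ℕ}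
    (hY : ∀ y ∈ Y \ X, #(colorNbrs c i y) ≤ t) (hp : #X ≤ p) (hq : #Y ≤ q)
    (hvol : m * Fintype.card V + 2 * (p * Fintype.card V + q * t)
      < volume (colorGraph c i) univ) :
    ∃ l, IsPathIn (colorGraph c i) (univ \ (X ∪ Y)) l ∧ l.length = m + 2 := by
  refine exists_isPathIn_of_volume _ ?_
  have h1 := volume_le_sdiff (G := colorGraph c i) (subset_univ (X ∪ Y))
  have h2 : ∑ x ∈ X ∪ Y, innerDegree (colorGraph c i) univ x
      ≤ p * Fintype.card V + q * t := by
    rw [← union_sdiff_self_eq_union, sum_union disjoint_sdiff]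
    have h3 : ∑ x ∈ X, innerDegree (colorGraph c i) univ x ≤ #X * Fintype.card V :=
      sum_le_card_nsmul _ _ _ fun x _ => card_le_univ _
    have h4 : ∑ x ∈ Y \ X, innerDegree (colorGraph c i) univ x ≤ #(Y \ X) * t :=
      sum_le_card_nsmul _ _ _ hY
    have h5 : #X * Fintype.card V ≤ p * Fintype.card V := Nat.mul_le_mul_right _ hp
    have h6 : #(Y \ X) * t ≤ q * t :=
      Nat.mul_le_mul_right _ ((card_le_card sdiff_subset).trans hq)
    omega
  have h7 : m * #(univ \ (X ∪ Y)) ≤ m * Fintype.card V := Nat.mul_le_mul_left _ (card_le_univ _)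
  omega

/-- One rare colour `β`, two rich colours. -/
theorem HasBalancedPath.of_one_rare (hc : AreColors α β γ) (hk : 2 ≤ k)
    (hT : Typical c {β} T t (3 * k + 3)) (hA : IsRich c α A d)
    (hC : IsRich c γ C d) (hAT : A ⊆ T) (hCT : C ⊆ T) (hd : 3 * k + t + 1 ≤ d)
    (hvol : 2 * k * Fintype.card V ≤ volume (colorGraph c β) univ) :
    HasBalancedPath c k := by
  set L : Finset V := {a | t ≤ #(colorNbrs c β a)} with hLdef
  have hL : ∀ a ∈ L, t ≤ #(colorNbrs c β a) := fun a ha => (mem_filter.1 ha).2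
  obtain ⟨h, hh⟩ : ∃ h, k = 2 * h ∨ k = 2 * h + 1 := Nat.even_or_odd' k
  rcases lt_or_ge #L (k - h) with hlt | hge
  · have hn : 0 < Fintype.card V := Fintype.card_pos_iff.2 ⟨hA.1.choose⟩
    obtain ⟨p, hp, hlen⟩ := exists_isPathIn_sdiff (c := c) (t := t) (i := β) (X := L) (Y := ∅)
      (m := k - 1) (p := k - h - 1) (q := 0) (by simp) (by omega) (by simp) (by
        have h1 : (k - 1) + 2 * (k - h - 1) < 2 * k := by omega
        have h2 := Nat.mul_lt_mul_of_pos_right h1 hn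
        rw [add_mul, mul_assoc 2 (k - h - 1)] at h2
        omega)
    refine HasBalancedPath.of_rare_path hc hk hA hC hd (fun x hx => ?_) hp (by omega)
    simpa [hLdef] using hx
  · rcases hh with hh | hh
    · exact HasBalancedPath.of_even_hubs hc hk hT hA hC hAT hd hL hh (by omega)
    · obtain ⟨a, ha⟩ : L.Nonempty := card_pos.1 (by omega)
      have hcard := card_erase_of_mem ha
      have hL' : ∀ b ∈ L.erase a, t ≤ #(colorNbrs c β b) := fun b hb => hL b (mem_of_mem_erase hb)
      by_cases hau : ∀ u ∈ A, c s(a, u) = β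
      · exact HasBalancedPath.of_odd_hubs_of_forall hc hk hT hA hC hAT hCT hd hL' hh (by omega)
          (hL a ha) (notMem_erase a L) hau
      · push Not at hau
        obtain ⟨u, hu, hau⟩ := hau
        exact HasBalancedPath.of_odd_hubs_of_ne hc hk hT hA hC hAT hd hL' hh (by omega)
          (hL a ha) (notMem_erase a L) hu hau

end OneRare

/-! ### Two rare colours -/

section TwoRare

variable {V : Type*} [Fintype V] [DecidableEq V] {c : Sym2 V → Fin 3} {α β γ : Fin 3} {k t : ℕ}
  {T : Finset V}

variable (c) in
/-- The vertices whose degree in colour `i` is at least `t`. -/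
def hubs (i : Fin 3) (t : ℕ) : Finset V := {a | t ≤ #(colorNbrs c i a)}

lemma mem_hubs {i : Fin 3} {a : V} : a ∈ hubs c i t ↔ t ≤ #(colorNbrs c i a) := by
  simp [hubs]

/-- A path that already has `k` edges of colour `α` and ends at a typical vertex is completed by
means of `β`-hubs, where the last hub is the end of the path if an odd number of `β`-edges is
missing. -/
lemma HasBalancedPath.of_hubs (hc : AreColors α β γ) (hT : Typical c {α, β} T t (3 * k + 3))
    (hV : t ≤ Fintype.card V) {x : V} {l : List V} (hx : x ∈ T) (hnd : (x :: l).Nodup)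
    (hα : colorCnt c α (x :: l) = k) (hβ : colorCnt c β (x :: l) ≤ k) {L : Finset V}
    (hL : ∀ a ∈ L, a ∈ hubs c β t ∧ a ∉ x :: l)
    (hcard : k ≤ colorCnt c β (x :: l) + 2 * #L)
    (hlen : l.length + (k - colorCnt c β (x :: l) + 1) / 2 ≤ 2 * k + colorCnt c β (x :: l)) :
    HasBalancedPath c k := by
  have hβB : β ∈ ({α, β} : Finset (Fin 3)) := by simp
  have hαB : α ∈ ({α, β} : Finset (Fin 3)) := by simp
  have hVt : t ≤ #(univ : Finset V) := by rwa [card_univ]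
  have hsum := colorCnt_add_add (c := c) hc x l
  set b := colorCnt c β (x :: l) with hb
  obtain ⟨q, hq⟩ : ∃ q, k - b = 2 * q ∨ k - b = 2 * q + 1 := Nat.even_or_odd' _
  obtain ⟨L', hL', hq'⟩ := exists_subset_card_eq (s := L) (n := q) (by omega)
  obtain ⟨x₁, l₁, hx₁, hnd₁, hlen₁, hβ₁, hj₁, hmem₁, -⟩ := hT.exists_cherries hβB hx L'
    (fun a ha => ⟨mem_hubs.1 (hL a (hL' ha)).1, (hL a (hL' ha)).2⟩) hnd (by omega)
  have hα₁ := hj₁ α hαB hc.1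
  rcases hq with hq | hq
  · obtain ⟨x₂, l₂, -, -, hnd₂, hlen₂, hi₂, -⟩ := hT.exists_steps hx₁ (mem_univ x₁) hVt hnd₁
      (3 * k - l₁.length) (by omega)
    exact HasBalancedPath.of_counts hc hnd₂ (by omega) (by rw [hi₂ α hαB]; omega)
      (by rw [hi₂ β hβB]; omega)
  · obtain ⟨x₂, l₂, hx₂, -, hnd₂, hlen₂, hi₂, hmem₂⟩ := hT.exists_steps hx₁ (mem_univ x₁) hVt hnd₁
      (3 * k - 2 - l₁.length) (by omega)
    obtain ⟨a, haL, haL'⟩ := exists_mem_notMem_of_card_lt_card (s := L') (t := L) (by omega)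
    have ha := mem_hubs.1 (hL a haL).1
    have haT := hT.notMem hβB ha
    obtain ⟨y, hy, hyT, hyl, hyx⟩ := hT.exists_mem hx₂ ha (l := x₂ :: l₂) (by simp; omega)
    rw [mem_colorNbrs] at hy
    have hal : a ∉ y :: x₂ :: l₂ := fun h => by
      rcases List.mem_cons.1 h with h | h
      · exact haT (h ▸ hyT)
      · rcases hmem₂ a h with h | h
        · rcases hmem₁ a h with h | h | h
          exacts [(hL a haL).2 h, haL' h, haT h]
        · exact haT h.2
    simp only [mem_insert, mem_singleton, not_or] at hyx
    refine HasBalancedPath.of_counts hc (x := a) (l := y :: x₂ :: l₂)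
      (List.nodup_cons.2 ⟨hal, List.nodup_cons.2 ⟨hyl, hnd₂⟩⟩) (by simp; omega) ?_ ?_
    · rw [colorCnt_cons_cons, colorCnt_cons_cons, if_neg hyx.1, hy.2, if_neg hc.1.symm, hi₂ α hαB]
      omega
    · rw [colorCnt_cons_cons, colorCnt_cons_cons, if_neg hyx.2, hy.2, if_pos rfl, hi₂ β hβB]
      omega

/-- At least `k` hubs in both rare colours: no other rare edges are needed. For odd `k`, a hub of
both colours contributes one edge of either, and a hub of just one of them is an end of the path. -/
lemma HasBalancedPath.of_many_hubs (hc : AreColors α β γ) (hk : 2 ≤ k)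
    (hT : Typical c {α, β} T t (3 * k + 3)) (hTne : T.Nonempty) (hV : t ≤ Fintype.card V)
    (hα : k ≤ #(hubs c α t)) (hβ : k ≤ #(hubs c β t)) : HasBalancedPath c k := by
  have hβB : β ∈ ({α, β} : Finset (Fin 3)) := by simp
  have hαB : α ∈ ({α, β} : Finset (Fin 3)) := by simp
  have hαT : ∀ a ∈ hubs c α t, a ∉ T := fun a ha => hT.notMem hαB (mem_hubs.1 ha)
  have hβT : ∀ a ∈ hubs c β t, a ∉ T := fun a ha => hT.notMem hβB (mem_hubs.1 ha)
  obtain ⟨x₀, hx₀⟩ := hTne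
  obtain ⟨h, hh | hh⟩ : ∃ h, k = 2 * h ∨ k = 2 * h + 1 := Nat.even_or_odd' k
  · obtain ⟨A, hA, hAc⟩ := exists_subset_card_eq (s := hubs c α t) (n := h) (by omega)
    obtain ⟨x₁, l₁, hx₁, hnd₁, hlen₁, hα₁, hj₁, hmem₁, -⟩ := hT.exists_cherries hαB
      (x := x₀) (l := []) hx₀ A (fun a ha => ⟨mem_hubs.1 (hA ha), fun h => by
        rw [List.mem_singleton] at h
        exact hαT a (hA ha) (h ▸ hx₀)⟩) (List.nodup_singleton _) (by simp; omega)
    have hβ₁ := hj₁ β hβB hc.1.symm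
    have hsd := le_card_sdiff A (hubs c β t)
    simp at hlen₁ hα₁ hβ₁
    refine HasBalancedPath.of_hubs hc hT hV hx₁ hnd₁ (by omega) (by omega) (L := hubs c β t \ A)
      (fun a ha => ?_) (by omega) (by omega)
    rw [Finset.mem_sdiff] at ha
    refine ⟨ha.1, fun h => ?_⟩
    rcases hmem₁ a h with h | h | h
    exacts [hβT a ha.1 ((List.mem_singleton.1 h) ▸ hx₀), ha.2 h, hβT a ha.1 h]
  · obtain ⟨a, ha⟩ : (hubs c α t).Nonempty := card_pos.1 (by omega)
    have haT := hαT a ha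
    obtain ⟨A, hA, hAc⟩ := exists_subset_card_eq (s := (hubs c α t).erase a) (n := h) (by
      rw [card_erase_of_mem ha]
      omega)
    have hAα : ∀ b ∈ A, b ∈ hubs c α t := fun b hb => mem_of_mem_erase (hA hb)
    have haA : a ∉ A := fun h => notMem_erase _ _ (hA h)
    obtain ⟨x, hx, hxT, -, -⟩ := hT.exists_mem hx₀ (mem_hubs.1 ha) (l := []) (by simp)
    rw [mem_colorNbrs] at hx
    have hxa : c s(x, a) = α := by rw [Sym2.eq_swap]; exact hx.2
    have hsd := le_card_sdiff A (hubs c β t)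
    by_cases haβ : a ∈ hubs c β t
    · obtain ⟨y, hy, hyT, hyx, -⟩ := hT.exists_mem hx₀ (mem_hubs.1 haβ) (l := [x]) (by simp)
      rw [mem_colorNbrs] at hy
      have hay : c s(a, y) = β := hy.2
      rw [List.mem_singleton] at hyx
      obtain ⟨x₁, l₁, hx₁, hnd₁, hlen₁, hα₁, hj₁, hmem₁, -⟩ := hT.exists_cherries hαB
        (x := x) (l := [a, y]) hxT A (fun b hb => ⟨mem_hubs.1 (hAα b hb), fun h => by
          simp only [List.mem_cons, List.not_mem_nil, or_false] at h
          rcases h with rfl | rfl | rfl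
          exacts [hαT _ (hAα _ hb) hxT, haA hb, hαT _ (hAα _ hb) hyT]⟩)
        (by simp [hx.1.symm, hy.1, Ne.symm hyx]) (by simp; omega)
      have hβ₁ := hj₁ β hβB hc.1.symm
      simp [hxa, hay, hc.1, hc.1.symm] at hlen₁ hα₁ hβ₁
      have hsd' := pred_card_le_card_erase (s := hubs c β t \ A) (a := a)
      refine HasBalancedPath.of_hubs hc hT hV hx₁ hnd₁ (by omega) (by omega)
        (L := (hubs c β t \ A).erase a) (fun b hb => ?_) (by omega) (by omega)
      rw [mem_erase, Finset.mem_sdiff] at hb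
      refine ⟨hb.2.1, fun h => ?_⟩
      rcases hmem₁ b h with h | h | h
      · simp only [List.mem_cons, List.not_mem_nil, or_false] at h
        rcases h with rfl | rfl | rfl
        exacts [hβT _ hb.2.1 hxT, hb.1 rfl, hβT _ hb.2.1 hyT]
      · exact hb.2.2 h
      · exact hβT _ hb.2.1 h
    · obtain ⟨x₁, l₁, hx₁, hnd₁, hlen₁, hα₁, hj₁, hmem₁, -⟩ := hT.exists_cherries hαB
        (x := x) (l := [a]) hxT A (fun b hb => ⟨mem_hubs.1 (hAα b hb), fun h => by
          simp only [List.mem_cons, List.not_mem_nil, or_false] at h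
          rcases h with rfl | rfl
          exacts [hαT _ (hAα _ hb) hxT, haA hb]⟩)
        (by simp [hx.1.symm]) (by simp; omega)
      have hβ₁ := hj₁ β hβB hc.1.symm
      simp [hxa, hc.1] at hlen₁ hα₁ hβ₁
      refine HasBalancedPath.of_hubs hc hT hV hx₁ hnd₁ (by omega) (by omega)
        (L := hubs c β t \ A) (fun b hb => ?_) (by omega) (by omega)
      rw [Finset.mem_sdiff] at hb
      refine ⟨hb.1, fun h => ?_⟩
      rcases hmem₁ b h with h | h | h
      · simp only [List.mem_cons, List.not_mem_nil, or_false] at h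
        rcases h with rfl | rfl
        exacts [hβT _ hb.1 hxT, haβ hb.1]
      · exact hb.2 h
      · exact hβT _ hb.1 h

/-- Fewer than `k` hubs of colour `α` and at least `k / 2` hubs of colour `β`: an `α`-path outside
the `α`-hubs provides the `α`-edges that `α`-hubs not needed for `β` cannot provide. -/
lemma HasBalancedPath.of_few_hubs_of_hubs (hc : AreColors α β γ) (hk : 2 ≤ k)
    (hT : Typical c {α, β} T t (3 * k + 3)) (hTne : T.Nonempty) (hV : 7 * t ≤ Fintype.card V)
    (hα : #(hubs c α t) < k) (hβ : (k + 1) / 2 ≤ #(hubs c β t))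
    (hvol : 2 * k * Fintype.card V + 6 * k * t ≤ volume (colorGraph c α) univ) :
    HasBalancedPath c k := by
  have hβB : β ∈ ({α, β} : Finset (Fin 3)) := by simp
  have hαB : α ∈ ({α, β} : Finset (Fin 3)) := by simp
  have hαT : ∀ a ∈ hubs c α t, a ∉ T := fun a ha => hT.notMem hαB (mem_hubs.1 ha)
  have hβT : ∀ a ∈ hubs c β t, a ∉ T := fun a ha => hT.notMem hβB (mem_hubs.1 ha)
  obtain ⟨x₀, hx₀⟩ := hTne
  have ht : 0 < t := by
    have := hT x₀ hx₀
    omega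
  obtain ⟨A₂, hA₂, hA₂c⟩ := exists_subset_card_eq hβ
  obtain ⟨A₁, hA₁, hA₁c⟩ := exists_subset_card_eq (le_card_sdiff A₂ (hubs c α t))
  have hA₁' : ∀ b ∈ A₁, b ∈ hubs c α t ∧ b ∉ A₂ := fun b hb => Finset.mem_sdiff.1 (hA₁ hb)
  rw [hA₂c] at hA₁c
  obtain ⟨p, hp, hplen⟩ := exists_isPathIn_sdiff (c := c) (t := t) (i := α) (X := hubs c α t)
    (Y := A₂) (m := k - 2 * #A₁ - 1) (p := #(hubs c α t)) (q := (k + 1) / 2) (fun y hy => by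
      rw [Finset.mem_sdiff, mem_hubs] at hy
      omega) le_rfl hA₂c.le (by
      have h1 : (k - 2 * #A₁ - 1) + 2 * #(hubs c α t) ≤ 2 * k := by omega
      have h2 := Nat.mul_le_mul_right (Fintype.card V) h1
      rw [add_mul, mul_assoc 2 (#(hubs c α t))] at h2
      have h3 : (2 * ((k + 1) / 2)) * t < (6 * k) * t := Nat.mul_lt_mul_of_pos_right (by omega) ht
      rw [mul_assoc 2] at h3
      omega)
  obtain ⟨u, l, rfl⟩ := List.exists_cons_of_length_eq_add_one hplen
  have hpS : ∀ b ∈ u :: l, b ∉ hubs c α t ∧ b ∉ A₂ := fun b hb => by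
    have := hp.2.2 b hb
    simpa using this
  have hu : #(colorNbrs c α u) < t := by
    have := (hpS u (by simp)).1
    rwa [mem_hubs, not_le] at this
  simp only [List.length_cons] at hplen
  obtain ⟨y, hy, hyT, hyl, -⟩ := hT.exists_mem hx₀ (N := univ \ colorNbrs c α u) (l := u :: l) (by
    rw [card_univ_sdiff]
    omega) (by simp; omega)
  have hyu : c s(y, u) ≠ α := fun h => by
    rw [Finset.mem_sdiff, mem_colorNbrs] at hy
    exact hy.2 ⟨fun h' => hyl (by simp [h']), by rwa [Sym2.eq_swap]⟩
  have hcnt := colorCnt_of_isPathIn hp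
  have hyα : colorCnt c α (y :: u :: l) = k - 2 * #A₁ := by
    rw [colorCnt_cons_cons, if_neg hyu, hcnt, if_pos rfl]
    simp
    omega
  have hyβ : colorCnt c β (y :: u :: l) ≤ 1 := by
    rw [colorCnt_cons_cons, hcnt, if_neg hc.1.symm]
    split_ifs <;> omega
  obtain ⟨x₁, l₁, hx₁, hnd₁, hlen₁, hα₁, hj₁, hmem₁, -⟩ := hT.exists_cherries hαB
    (x := y) (l := u :: l) hyT A₁ (fun b hb => ⟨mem_hubs.1 (hA₁' b hb).1, fun h => by
      rcases List.mem_cons.1 h with h | h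
      exacts [hαT b (hA₁' b hb).1 (h ▸ hyT), (hpS b h).1 (hA₁' b hb).1]⟩)
    (List.nodup_cons.2 ⟨hyl, hp.1⟩) (by simp; omega)
  have hβ₁ := hj₁ β hβB hc.1.symm
  simp only [List.length_cons] at hlen₁
  refine HasBalancedPath.of_hubs hc hT (by omega) hx₁ hnd₁ (by omega) (by omega)
    (L := A₂) (fun b hb => ⟨hA₂ hb, fun h => ?_⟩) (by omega) (by omega)
  rcases hmem₁ b h with h | h | h
  · rcases List.mem_cons.1 h with h | h
    exacts [hβT b (hA₂ hb) (h ▸ hyT), (hpS b h).2 hb]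
  · exact (hA₁' b h).2 hb
  · exact hβT b (hA₂ hb) h

/-- Few hubs of both rare colours: two paths with `k` edges, one in each rare colour, are linked by
exactly `k` edges of colour `γ`. -/
lemma HasBalancedPath.of_few_hubs (hc : AreColors α β γ) (hk : 2 ≤ k)
    (hT : Typical c {α, β} T t (3 * k + 3)) (hTne : T.Nonempty) (hV : 7 * t ≤ Fintype.card V)
    (hα : #(hubs c α t) < (k + 1) / 2) (hβ : #(hubs c β t) < (k + 1) / 2)
    (hvolα : 2 * k * Fintype.card V + 6 * k * t ≤ volume (colorGraph c α) univ)
    (hvolβ : 2 * k * Fintype.card V + 6 * k * t ≤ volume (colorGraph c β) univ) :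
    HasBalancedPath c k := by
  have hβB : β ∈ ({α, β} : Finset (Fin 3)) := by simp
  have hαB : α ∈ ({α, β} : Finset (Fin 3)) := by simp
  obtain ⟨x₀, hx₀⟩ := hTne
  have ht := hT x₀ hx₀
  obtain ⟨p, hp, hplen⟩ := exists_isPathIn_sdiff (c := c) (t := t) (i := α) (X := hubs c α t)
    (Y := hubs c β t) (m := k - 1) (p := k / 2) (q := k) (fun y hy => by
      rw [Finset.mem_sdiff, mem_hubs (i := α)] at hy
      omega) (by omega) (by omega) (by
      have h1 : (k - 1) + 2 * (k / 2) < 2 * k := by omega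
      have h2 := Nat.mul_lt_mul_of_pos_right h1 (show 0 < Fintype.card V by omega)
      rw [add_mul, mul_assoc 2 (k / 2)] at h2
      have h3 : (2 * k) * t ≤ (6 * k) * t := Nat.mul_le_mul_right _ (by omega)
      rw [mul_assoc 2 k t] at h3
      omega)
  have hpS : ∀ b ∈ p, b ∉ hubs c α t ∧ b ∉ hubs c β t := fun b hb => by
    have := hp.2.2 b hb
    simpa using this
  obtain ⟨q, hq, hqlen⟩ := exists_isPathIn_sdiff (c := c) (t := t) (i := β) (X := hubs c β t)
    (Y := hubs c α t ∪ p.toFinset) (m := k - 1) (p := k / 2) (q := 3 * k) (fun y hy => by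
      rw [Finset.mem_sdiff, mem_hubs (i := β)] at hy
      omega) (by omega) (by
      have h1 := card_union_le (hubs c α t) p.toFinset
      have h2 := p.toFinset_card_le
      omega) (by
      have h1 : (k - 1) + 2 * (k / 2) < 2 * k := by omega
      have h2 := Nat.mul_lt_mul_of_pos_right h1 (show 0 < Fintype.card V by omega)
      rw [add_mul, mul_assoc 2 (k / 2)] at h2
      have h3 : 6 * k * t = 2 * (3 * k * t) := by ring
      omega)
  have hqS : ∀ b ∈ q, b ∉ hubs c β t ∧ b ∉ hubs c α t ∧ b ∉ p := fun b hb => by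
    have := hq.2.2 b hb
    simpa using this
  obtain ⟨u, l, rfl⟩ := List.exists_cons_of_length_eq_add_one hplen
  obtain ⟨v, m, rfl⟩ := List.exists_cons_of_length_eq_add_one hqlen
  have low : ∀ {b : V} {i : Fin 3}, b ∉ hubs c i t → #(colorNbrs c i b) < t := fun h => by
    rwa [mem_hubs, not_le] at h
  have huα := low (hpS u (by simp)).1
  have huβ := low (hpS u (by simp)).2
  have hvβ := low (hqS v (by simp)).1
  have hvα := low (hqS v (by simp)).2.1
  -- the interior vertices of the link are chosen in `N`, so that each of them may be the last
  obtain ⟨F, hF⟩ : ∃ F, F = colorNbrs c α v ∪ colorNbrs c β v ∪ (v :: m).toFinset := ⟨_, rfl⟩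
  have hFc : #F ≤ 2 * t + (k + 1) := by
    have h1 := card_union_le (colorNbrs c α v ∪ colorNbrs c β v) (v :: m).toFinset
    have h2 := card_union_le (colorNbrs c α v) (colorNbrs c β v)
    have h3 := (v :: m).toFinset_card_le
    rw [hF]
    omega
  obtain ⟨U, hU⟩ : ∃ U, U = colorNbrs c α u ∪ colorNbrs c β u := ⟨_, rfl⟩
  have hUc : #U ≤ 2 * t := by
    have h2 := card_union_le (colorNbrs c α u) (colorNbrs c β u)
    rw [hU]
    omega
  simp only [List.length_cons] at hplen hqlen
  obtain ⟨x, hx, hxT, hxl, -⟩ := hT.exists_mem hx₀ (N := univ \ (F ∪ U)) (l := u :: l) (by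
    rw [card_univ_sdiff]
    have := card_union_le F U
    omega) (by simp; omega)
  have hxF : x ∈ univ \ F := by
    simp only [Finset.mem_sdiff, mem_univ, mem_union, true_and, not_or] at hx ⊢
    exact hx.1
  have hxu : c s(x, u) ≠ α ∧ c s(x, u) ≠ β := by
    simp only [hU, Finset.mem_sdiff, mem_univ, mem_union, true_and, not_or, mem_colorNbrs,
      not_and] at hx
    have hux : u ≠ x := fun h => hxl (by simp [h])
    rw [Sym2.eq_swap]
    exact ⟨hx.2.1 hux, hx.2.2 hux⟩
  obtain ⟨x₁, l₁, -, hx₁F, hnd₁, hlen₁, hi₁, hmem₁⟩ := hT.exists_steps hxT hxF (by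
    rw [card_univ_sdiff]
    omega) (List.nodup_cons.2 ⟨hxl, hp.1⟩) (k - 2) (by simp; omega)
  have hvx : c s(v, x₁) ≠ α ∧ c s(v, x₁) ≠ β := by
    simp only [hF, Finset.mem_sdiff, mem_univ, mem_union, true_and, not_or, mem_colorNbrs,
      not_and, List.toFinset_cons, mem_insert] at hx₁F
    have hvx : v ≠ x₁ := fun h => hx₁F.2.1 h.symm
    exact ⟨hx₁F.1.1 hvx, hx₁F.1.2 hvx⟩
  obtain ⟨y, r, hr⟩ : ∃ y r, (v :: m).reverse ++ x₁ :: l₁ = y :: r :=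
    List.exists_cons_of_ne_nil (by simp)
  have hrl := congrArg List.length hr
  simp only [List.length_append, List.length_reverse, List.length_cons] at hrl hlen₁
  refine HasBalancedPath.of_counts hc (x := y) (l := r) ?_ (by omega) ?_ ?_
  · rw [← hr, List.nodup_append]
    refine ⟨List.nodup_reverse.2 hq.1, hnd₁, fun b hb b' hb' hbb => ?_⟩
    subst hbb
    rw [List.mem_reverse] at hb
    have hbF : b ∉ univ \ F := fun h => by
      rw [Finset.mem_sdiff] at h
      exact h.2 (hF ▸ mem_union_right _ (List.mem_toFinset.2 hb))
    rcases hmem₁ b hb' with h | h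
    · rcases List.mem_cons.1 h with rfl | h
      exacts [hbF hxF, (hqS b hb).2.2 h]
    · exact hbF h.1
  · rw [← hr, colorCnt_reverse_append, if_neg hvx.1, hi₁ α hαB, colorCnt_cons_cons, if_neg hxu.1,
      colorCnt_of_isPathIn hp, colorCnt_of_isPathIn hq, if_neg hc.1, if_pos rfl]
    simp
    omega
  · rw [← hr, colorCnt_reverse_append, if_neg hvx.2, hi₁ β hβB, colorCnt_cons_cons, if_neg hxu.2,
      colorCnt_of_isPathIn hp, colorCnt_of_isPathIn hq, if_neg hc.1.symm, if_pos rfl]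
    simp
    omega

/-- Two rare colours `α` and `β`. -/
theorem HasBalancedPath.of_two_rare (hc : AreColors α β γ) (hk : 2 ≤ k)
    (hT : Typical c {α, β} T t (3 * k + 3)) (hTne : T.Nonempty) (hV : 7 * t ≤ Fintype.card V)
    (hvolα : 2 * k * Fintype.card V + 6 * k * t ≤ volume (colorGraph c α) univ)
    (hvolβ : 2 * k * Fintype.card V + 6 * k * t ≤ volume (colorGraph c β) univ) :
    HasBalancedPath c k := by
  have hT' : Typical c {β, α} T t (3 * k + 3) := by rwa [pair_comm]
  by_cases h1 : k ≤ #(hubs c α t) ∧ k ≤ #(hubs c β t)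
  · exact HasBalancedPath.of_many_hubs hc hk hT hTne (by omega) h1.1 h1.2
  by_cases h2 : #(hubs c α t) < k ∧ (k + 1) / 2 ≤ #(hubs c β t)
  · exact HasBalancedPath.of_few_hubs_of_hubs hc hk hT hTne hV h2.1 h2.2 hvolα
  by_cases h3 : #(hubs c β t) < k ∧ (k + 1) / 2 ≤ #(hubs c α t)
  · exact HasBalancedPath.of_few_hubs_of_hubs hc.swap₁₂ hk hT' hTne hV h3.1 h3.2 hvolβ
  · exact HasBalancedPath.of_few_hubs hc hk hT hTne hV (by omega) (by omega) hvolα hvolβ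

end TwoRare

/-! ### Paths with one edge of each colour -/

section Rainbow

variable {V : Type*} {c : Sym2 V → Fin 3} {α β γ : Fin 3}

lemma HasBalancedPath.of_rainbow {x y z w : V} (hxy : x ≠ y) (hyz : y ≠ z)
    (hzw : z ≠ w) (hxz : x ≠ z) (hyw : y ≠ w) (hxw : x ≠ w) (h₁ : c s(x, y) ≠ c s(y, z))
    (h₂ : c s(y, z) ≠ c s(z, w)) (h₃ : c s(x, y) ≠ c s(z, w)) : HasBalancedPath c 1 :=
  HasBalancedPath.of_counts ⟨h₁, h₂, h₃⟩ (x := x) (l := [y, z, w])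
    (by simp [hxy, hyz, hzw, hxz, hyw, hxw]) rfl
    (by simp [h₁.symm, h₃.symm]) (by simp [h₁, h₂.symm])

/-- A vertex incident with all three colours yields a rainbow path with three edges. -/
lemma HasBalancedPath.of_three_colors_at [Fintype V] [DecidableEq V]
    (hV : 5 ≤ Fintype.card V) {v : V} (h : ∀ i, ∃ u, v ≠ u ∧ c s(v, u) = i) :
    HasBalancedPath c 1 := by
  obtain ⟨x, hx, hvx⟩ := h 0
  obtain ⟨y, hy, hvy⟩ := h 1
  obtain ⟨z, hz, hvz⟩ := h 2
  have hxy : x ≠ y := fun h => by simp [← h, hvx] at hvy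
  have hyz : y ≠ z := fun h => by simp [← h, hvy] at hvz
  have hxz : x ≠ z := fun h => by simp [← h, hvx] at hvz
  obtain ⟨w, -, hw⟩ := exists_mem_notMem_of_card_lt_card (s := {v, x, y, z}) (t := univ) (by
    have := card_le_four (a := v) (b := x) (c := y) (d := z)
    rw [card_univ]
    omega)
  simp only [mem_insert, mem_singleton, not_or] at hw
  obtain ⟨hwv, hwx, hwy, hwz⟩ := hw
  have exv : c s(x, v) = c s(v, x) := by rw [Sym2.eq_swap]
  have eyv : c s(y, v) = c s(v, y) := by rw [Sym2.eq_swap]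
  have ezv : c s(z, v) = c s(v, z) := by rw [Sym2.eq_swap]
  have eyx : c s(y, x) = c s(x, y) := by rw [Sym2.eq_swap]
  have ezx : c s(z, x) = c s(x, z) := by rw [Sym2.eq_swap]
  have ewv : c s(w, v) = c s(v, w) := by rw [Sym2.eq_swap]
  by_contra hno
  -- the edges `xy` and `xz` are forced to have the colours of `vz` and `vy`, and then a further
  -- edge `wv` starts a rainbow path
  have h1 := fun a b d => hno (HasBalancedPath.of_rainbow hz.symm hx hxy hxz.symm hy hyz.symm a b d)
  have h2 := fun a b d => hno (HasBalancedPath.of_rainbow hz.symm hy hxy.symm hyz.symm hx hxz.symm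
    a b d)
  have h3 := fun a b d => hno (HasBalancedPath.of_rainbow hy.symm hx hxz hxy.symm hz hyz a b d)
  have h4 := fun a b d => hno (HasBalancedPath.of_rainbow hy.symm hz hxz.symm hyz hx hxy.symm a b d)
  have h5 := fun a b d => hno (HasBalancedPath.of_rainbow hwv hy hxy.symm hwy hx hwx a b d)
  have h6 := fun a b d => hno (HasBalancedPath.of_rainbow hwv hx hxy hwx hy hwy a b d)
  have h7 := fun a b d => hno (HasBalancedPath.of_rainbow hwv hx hxz hwx hz hwz a b d)
  rw [exv, eyv, ezv, eyx, ezx, ewv, hvx, hvy, hvz] at *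
  clear exv eyv ezv eyx ezx ewv
  revert h1 h2 h3 h4 h5 h6 h7
  generalize c s(x, y) = p
  generalize c s(x, z) = q
  generalize c s(v, w) = r
  intro h1 h2 h3 h4 h5 h6 h7
  grind

/-- For `k = 1` it suffices that all three colours occur. -/
theorem HasBalancedPath.one [Fintype V] [DecidableEq V] (hV : 5 ≤ Fintype.card V)
    (h : ∀ i, ∃ x y, x ≠ y ∧ c s(x, y) = i) : HasBalancedPath c 1 := by
  by_contra hno
  obtain ⟨v, p, q, hpq, ⟨u₁, hu₁, hp⟩, ⟨u₂, hu₂, hq⟩⟩ : ∃ v p q, p ≠ q ∧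
      (∃ u, v ≠ u ∧ c s(v, u) = p) ∧ ∃ u, v ≠ u ∧ c s(v, u) = q := by
    obtain ⟨a, b, hab, h0⟩ := h 0
    obtain ⟨x, y, hxy, h1⟩ := h 1
    rcases eq_or_ne a x with rfl | hax
    · exact ⟨a, 0, 1, by decide, ⟨b, hab, h0⟩, ⟨y, hxy, h1⟩⟩
    by_cases h2 : c s(a, x) = 0
    · exact ⟨x, 0, 1, by decide, ⟨a, hax.symm, by rwa [Sym2.eq_swap]⟩, ⟨y, hxy, h1⟩⟩
    · exact ⟨a, 0, c s(a, x), fun h => h2 h.symm, ⟨b, hab, h0⟩, ⟨x, hax, rfl⟩⟩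
  obtain ⟨r, hr⟩ : ∃ r, AreColors p q r := by
    have : ∀ p q : Fin 3, p ≠ q → ∃ r, AreColors p q r := by
      unfold AreColors
      decide
    exact this p q hpq
  obtain ⟨x, y, hxy, hxyr⟩ := h r
  have hvr : ∀ u, v ≠ u → c s(v, u) ≠ r := fun u hu hur =>
    hno (HasBalancedPath.of_three_colors_at hV (v := v) fun i => by
      rcases hr.eq_or i with rfl | rfl | rfl
      exacts [⟨u₁, hu₁, hp⟩, ⟨u₂, hu₂, hq⟩, ⟨u, hu, hur⟩])
  have hvx : v ≠ x := fun h => hvr y (h ▸ hxy) (h ▸ hxyr)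
  have hvy : v ≠ y := fun h => hvr x (h ▸ hxy.symm) (by rw [Sym2.eq_swap, h]; exact hxyr)
  have key : ∀ u, u ≠ v → u ≠ x → u ≠ y → c s(v, u) = c s(v, x) ∧ c s(v, u) = c s(v, y) := by
    intro u hu hux huy
    have e1 : c s(u, v) = c s(v, u) := by rw [Sym2.eq_swap]
    have e2 : c s(y, x) = r := by rw [Sym2.eq_swap, hxyr]
    constructor
    · by_contra hne
      refine hno (HasBalancedPath.of_rainbow hu hvx hxy hux hvy huy (by rwa [e1]) ?_ ?_)
      · rw [hxyr]
        exact hvr x hvx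
      · rw [hxyr, e1]
        exact hvr u hu.symm
    · by_contra hne
      refine hno (HasBalancedPath.of_rainbow hu hvy hxy.symm huy hvx hux (by rwa [e1]) ?_ ?_)
      · rw [e2]
        exact hvr y hvy
      · rw [e2, e1]
        exact hvr u hu.symm
  obtain ⟨w, -, hw⟩ := exists_mem_notMem_of_card_lt_card (s := {v, x, y}) (t := univ) (by
    have := card_le_three (a := v) (b := x) (c := y)
    rw [card_univ]
    omega)
  simp only [mem_insert, mem_singleton, not_or] at hw
  have hwk := key w hw.1 hw.2.1 hw.2.2
  have hall : ∀ u, v ≠ u → c s(v, u) = c s(v, w) := fun u hu => by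
    by_cases hux : u = x
    · rw [hux, hwk.1]
    by_cases huy : u = y
    · rw [huy, hwk.2]
    · rw [(key u hu.symm hux huy).1, hwk.1]
  exact hpq (by rw [← hp, ← hq, hall u₁ hu₁, hall u₂ hu₂])

end Rainbow

/-! ### Choice of parameters -/

section Parameters

variable {V : Type*} [Fintype V] [DecidableEq V] {c : Sym2 V → Fin 3}

lemma exists_typical {B : Finset (Fin 3)} {R s t M : ℕ}
    (hvol : ∑ i ∈ B, volume (colorGraph c i) univ ≤ R * s) (ht : R + s + M < t) (hs : 0 < s) :
    ∃ T, Typical c B T t M ∧ #Tᶜ ≤ R := by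
  have hT : #({x | ∑ i ∈ B, #(colorNbrs c i x) < s} : Finset V)ᶜ ≤ R := by
    refine Nat.le_of_mul_le_mul_right (le_trans ?_ hvol) hs
    have h1 : ∑ i ∈ B, volume (colorGraph c i) univ = ∑ x, ∑ i ∈ B, #(colorNbrs c i x) :=
      sum_comm
    rw [h1, ← smul_eq_mul]
    refine (card_nsmul_le_sum _ (fun x => ∑ i ∈ B, #(colorNbrs c i x)) s fun x hx => ?_).trans
      (sum_le_sum_of_subset (subset_univ _))
    simpa using hx
  refine ⟨_, fun x hx => ?_, hT⟩
  have hx' : ∑ i ∈ B, #(colorNbrs c i x) < s := by simpa using hx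
  have h2 : #{y | c s(x, y) ∈ B} ≤ s := by
    have h3 : ({y | c s(x, y) ∈ B} : Finset V) ⊆ insert x (B.biUnion fun i => colorNbrs c i x) := by
      intro y hy
      rw [mem_insert, mem_biUnion]
      rcases eq_or_ne x y with h | h
      · exact .inl h.symm
      · exact .inr ⟨c s(x, y), (mem_filter.1 hy).2, mem_colorNbrs.2 ⟨h, rfl⟩⟩
    have h4 := (card_le_card h3).trans (card_insert_le _ _)
    have h5 := card_biUnion_le (s := B) (t := fun i => colorNbrs c i x)
    omega
  omega

lemma exists_isRich {i : Fin 3} {d R : ℕ} {T : Finset V} (hT : #Tᶜ ≤ R)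
    (hvol : 2 * d * Fintype.card V + 2 * (R * Fintype.card V) < volume (colorGraph c i) univ) :
    ∃ Q ⊆ T, IsRich c i Q d := by
  obtain ⟨Q, hQ, h⟩ := exists_minDegree_subset (G := colorGraph c i) (d := d) T (by
    have h1 := volume_le_sdiff (G := colorGraph c i) (subset_univ Tᶜ)
    have h2 : ∑ x ∈ Tᶜ, innerDegree (colorGraph c i) univ x ≤ #Tᶜ * Fintype.card V :=
      sum_le_card_nsmul _ _ _ fun x _ => card_le_univ _
    have h3 : #Tᶜ * Fintype.card V ≤ R * Fintype.card V := Nat.mul_le_mul_right _ hT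
    have h4 : 2 * d * #T ≤ 2 * d * Fintype.card V := Nat.mul_le_mul_left _ (card_le_univ _)
    rw [← compl_eq_univ_sdiff, compl_compl] at h1
    omega)
  exact ⟨Q, hQ, h⟩

/-- The constant in front of `n ^ (3 / 4)` in the upper bound. -/
def errorConst (k : ℕ) : ℕ := 10 * (12 * k + 19) + 3

theorem HasBalancedPath.of_volume {k m : ℕ} (hk : 2 ≤ k) (hm : 7 * errorConst k ≤ m)
    (hn : m ^ 4 ≤ Fintype.card V) (hn' : Fintype.card V ≤ 2 * m ^ 4)
    (hvol : ∀ i, 2 * k * Fintype.card V + 6 * k * (errorConst k * m ^ 3)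
      ≤ volume (colorGraph c i) univ) : HasBalancedPath c k := by
  set n := Fintype.card V with hndef
  have hm1 : 1 ≤ m := by unfold errorConst at hm; omega
  have hmk : 12 * k + 19 ≤ m := by unfold errorConst at hm; omega
  have hm2 : m ≤ m ^ 2 := Nat.le_self_pow (by norm_num) m
  have hm3 : m ≤ m ^ 3 := Nat.le_self_pow (by norm_num) m
  -- either all colours are rich, or some colour `β` has only linearly many edges
  by_cases hrich : ∀ i, 2 * (3 * k + 4) * n + 2 * (0 * n) < volume (colorGraph c i) univ
  · obtain ⟨A, -, hA⟩ := exists_isRich (c := c) (T := univ) (R := 0) (by simp) (hrich 0)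
    obtain ⟨Q, -, hQ⟩ := exists_isRich (c := c) (T := univ) (R := 0) (by simp) (hrich 1)
    obtain ⟨C, -, hC⟩ := exists_isRich (c := c) (T := univ) (R := 0) (by simp) (hrich 2)
    exact HasBalancedPath.of_three_rich ⟨by decide, by decide, by decide⟩ hk hA hQ hC le_rfl
  push Not at hrich
  obtain ⟨β, hβ⟩ := hrich
  obtain ⟨α, γ, hc, hαγ⟩ : ∃ α γ, AreColors α β γ ∧
      volume (colorGraph c α) univ ≤ volume (colorGraph c γ) univ := by
    have h : ∃ α γ, AreColors α β γ := by
      have : ∀ β : Fin 3, ∃ α γ, AreColors α β γ := by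
        unfold AreColors
        decide
      exact this β
    obtain ⟨α, γ, hc⟩ := h
    rcases le_total (volume (colorGraph c α) univ) (volume (colorGraph c γ) univ) with h | h
    exacts [⟨α, γ, hc, h⟩, ⟨γ, α, hc.swap₁₃, h⟩]
  -- `γ` is at least as frequent as `α`, and `α` is rich or has `O(n ^ (3 / 2))` edges
  obtain ⟨T, hT, hTc⟩ := exists_typical (c := c) (B := {β}) (R := (12 * k + 16) * m ^ 2)
    (s := m ^ 2) (t := (12 * k + 18) * m ^ 2 + 1) (M := 3 * k + 3) (by
      rw [sum_singleton]
      have h1 : (6 * k + 8) * n ≤ (6 * k + 8) * (2 * m ^ 4) := Nat.mul_le_mul_left _ hn'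
      have h2 : (12 * k + 16) * m ^ 2 * m ^ 2 = (6 * k + 8) * (2 * m ^ 4) := by ring
      rw [h2]
      refine le_trans hβ (le_trans (le_of_eq ?_) h1)
      ring) (by
      have : (12 * k + 18) * m ^ 2 = (12 * k + 16) * m ^ 2 + m ^ 2 + m ^ 2 := by ring
      omega) (by positivity)
  have hT' : (12 * k + 16) * m ^ 2 < n := by
    refine lt_of_lt_of_le ?_ hn
    have h1 : (12 * k + 16) * m ^ 2 < m ^ 2 * m ^ 2 :=
      Nat.mul_lt_mul_of_pos_right (by omega) (by positivity)
    calc (12 * k + 16) * m ^ 2 < m ^ 2 * m ^ 2 := h1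
      _ = m ^ 4 := by ring
  by_cases hα : 2 * (3 * k + ((12 * k + 18) * m ^ 2 + 1) + 1) * n
      + 2 * ((12 * k + 16) * m ^ 2 * n) < volume (colorGraph c α) univ
  · obtain ⟨A, hAT, hA⟩ := exists_isRich hTc hα
    obtain ⟨C, hCT, hC⟩ := exists_isRich hTc (hα.trans_le hαγ)
    exact HasBalancedPath.of_one_rare hc hk hT hA hC hAT hCT le_rfl
      ((Nat.le_add_right _ _).trans (hvol β))
  push Not at hα
  set s := m ^ 3 with hs
  obtain ⟨T', hT', hTc'⟩ := exists_typical (c := c) (B := {α, β})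
    (R := 10 * (12 * k + 19) * s) (s := s) (t := errorConst k * s) (M := 3 * k + 3) (by
      rw [sum_pair hc.1]
      have h1 : (60 * k + 80) * m ^ 2 * n ≤ (60 * k + 80) * m ^ 2 * (2 * m ^ 4) :=
        Nat.mul_le_mul_left _ hn'
      have h2 : (12 * k + 12) * n ≤ (12 * k + 12) * m ^ 2 * n :=
        Nat.mul_le_mul_right _ (Nat.le_mul_of_pos_right _ (by positivity))
      have h3 : 0 ≤ m ^ 6 := Nat.zero_le _
      calc volume (colorGraph c α) univ + volume (colorGraph c β) univ
          ≤ (60 * k + 80) * m ^ 2 * n := by linarith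
        _ ≤ (60 * k + 80) * m ^ 2 * (2 * m ^ 4) := h1
        _ = (120 * k + 160) * m ^ 6 := by ring
        _ ≤ (120 * k + 190) * m ^ 6 := Nat.mul_le_mul_right _ (by omega)
        _ = 10 * (12 * k + 19) * s * s := by rw [hs]; ring) (by
      have : errorConst k * s = 10 * (12 * k + 19) * s + s + s + s := by
        unfold errorConst
        ring
      omega) (by positivity)
  have h4 : m ^ 4 = m * s := by rw [hs]; ring
  have hne : T'.Nonempty := by
    by_contra hne
    rw [not_nonempty_iff_eq_empty] at hne
    rw [hne, compl_empty, card_univ, ← hndef] at hTc'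
    have h5 : 10 * (12 * k + 19) * s < m * s :=
      Nat.mul_lt_mul_of_pos_right (by unfold errorConst at hm; omega) (by positivity)
    omega
  exact HasBalancedPath.of_two_rare hc hk hT' hne (by
    refine le_trans ?_ hn
    rw [h4, ← mul_assoc]
    exact Nat.mul_le_mul_right _ hm) (hvol α) (hvol β)

end Parameters

/-! ### Coloured graphs and vertex lists -/

section Bridge

/-- The labelling `C` of the edges of `K_n` as a function on all unordered pairs, with the
value `0` on the diagonal. -/
def pairColor {n : ℕ} (C : SimpleGraph.TopEdgeLabeling (Fin n) (Fin 3)) (e : Sym2 (Fin n)) :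
    Fin 3 :=
  if h : e ∈ (⊤ : SimpleGraph (Fin n)).edgeSet then C ⟨e, h⟩ else 0

lemma pairColor_coe {n : ℕ} (C : SimpleGraph.TopEdgeLabeling (Fin n) (Fin 3))
    (e : (⊤ : SimpleGraph (Fin n)).edgeSet) : pairColor C e = C e := by
  unfold pairColor
  rw [dif_pos e.2]

lemma mem_edgeSet_colorGraph {n : ℕ} {C : SimpleGraph.TopEdgeLabeling (Fin n) (Fin 3)} {i : Fin 3}
    {e : Sym2 (Fin n)} : e ∈ (colorGraph (pairColor C) i).edgeSet ↔
      e ∈ (⊤ : SimpleGraph (Fin n)).edgeSet ∧ pairColor C e = i := by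
  induction e with
  | _ x y => simp [colorGraph_adj]

lemma volume_eq_two_mul_colorCount {n : ℕ} (C : SimpleGraph.TopEdgeLabeling (Fin n) (Fin 3))
    (i : Fin 3) : volume (colorGraph (pairColor C) i) univ = 2 * colorCount C i := by
  have h1 : volume (colorGraph (pairColor C) i) univ
      = ∑ x, (colorGraph (pairColor C) i).degree x := by
    refine sum_congr rfl fun x _ => ?_
    rw [← SimpleGraph.card_neighborFinset_eq_degree, SimpleGraph.neighborFinset_eq_filter]
    rfl
  rw [h1, SimpleGraph.sum_degrees_eq_twice_card_edges, SimpleGraph.edgeFinset_card,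
    ← Nat.card_eq_fintype_card, colorCount]
  congr 1
  refine Nat.card_congr ⟨fun e => ⟨⟨e.1, (mem_edgeSet_colorGraph.1 e.2).1⟩, ?_⟩,
    fun e => ⟨e.1.1, mem_edgeSet_colorGraph.2 ⟨e.1.2, ?_⟩⟩, fun e => rfl, fun e => rfl⟩
  · exact (pairColor_coe C _).symm.trans (mem_edgeSet_colorGraph.1 e.2).2
  · rw [pairColor_coe]
    exact e.2

lemma path_adj {m : ℕ} (j : Fin m) : (path m).Adj j.castSucc j.succ := by
  rw [SimpleGraph.pathGraph_adj]
  simp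

/-- The `j`-th edge of a graph that is isomorphic to a path. -/
def pathEdge {m : ℕ} {W : Type} {G : SimpleGraph W} (φ : path m ≃g G) (j : Fin m) : G.edgeSet :=
  ⟨s(φ j.castSucc, φ j.succ), φ.map_adj_iff.2 (path_adj j)⟩

lemma pathEdge_bijective {m : ℕ} {W : Type} {G : SimpleGraph W} (φ : path m ≃g G) :
    Function.Bijective (pathEdge φ) := by
  constructor
  · intro i j h
    have h' := congrArg Subtype.val h
    simp only [pathEdge, Sym2.eq_iff, φ.injective.eq_iff, Fin.ext_iff, Fin.val_castSucc,
      Fin.val_succ] at h'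
    ext
    omega
  · rintro ⟨e, he⟩
    induction e with
    | _ x y =>
      obtain ⟨a, rfl⟩ := φ.surjective x
      obtain ⟨b, rfl⟩ := φ.surjective y
      have hab : (path m).Adj a b := φ.map_adj_iff.1 he
      rw [SimpleGraph.pathGraph_adj] at hab
      rcases hab with h | h
      · refine ⟨⟨a, by omega⟩, Subtype.ext ?_⟩
        have h1 : (⟨a, by omega⟩ : Fin m).succ = b := Fin.ext h
        simp only [pathEdge, h1]
        rfl
      · refine ⟨⟨b, by omega⟩, Subtype.ext ?_⟩
        have h1 : (⟨b, by omega⟩ : Fin m).succ = a := Fin.ext h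
        simp only [pathEdge, h1]
        rw [Sym2.eq_swap]
        rfl

lemma card_edgeSet_of_iso {m : ℕ} {W : Type} {G : SimpleGraph W} (φ : path m ≃g G) :
    Nat.card G.edgeSet = m := by
  rw [← Nat.card_eq_of_bijective _ (pathEdge_bijective φ), Nat.card_fin]

lemma colorCount_eq_card {m : ℕ} {W : Type} {G : SimpleGraph W} (φ : path m ≃g G)
    (D : G.EdgeLabeling (Fin 3)) (i : Fin 3) :
    colorCount D i = #{j | D (pathEdge φ j) = i} := by
  have h := Nat.card_eq_of_bijective _
    ((Equiv.ofBijective _ (pathEdge_bijective φ)).subtypeEquiv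
      (p := fun j => D (pathEdge φ j) = i) (q := fun e => D e = i) (fun j => Iff.rfl)).bijective
  rw [colorCount, ← h, Nat.card_eq_fintype_card, Fintype.card_subtype]

lemma isBalanced_iff {k : ℕ} {W : Type} {G : SimpleGraph W} (φ : path (3 * k) ≃g G)
    (D : G.EdgeLabeling (Fin 3)) :
    IsBalanced D ↔ ∀ i, #{j | D (pathEdge φ j) = i} = k := by
  unfold IsBalanced
  simp only [card_edgeSet_of_iso φ, colorCount_eq_card φ, Nat.ceilDiv_eq_add_pred_div]
  refine forall_congr' fun i => ?_
  omega

/-- A copy of a balanced path is an injective sequence of vertices. -/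
lemma exists_contains_iff {n k : ℕ} (C : SimpleGraph.TopEdgeLabeling (Fin n) (Fin 3)) :
    (∃ H ∈ balancedFamily 3 (path (3 * k)), Contains C H) ↔
      ∃ g : Fin (3 * k + 1) → Fin n, Function.Injective g ∧
        ∀ i, #{j : Fin (3 * k) | pairColor C s(g j.castSucc, g j.succ) = i} = k := by
  constructor
  · rintro ⟨H, ⟨⟨φ⟩, hbal⟩, f, hf⟩
    refine ⟨fun j => f (φ.symm j), f.injective.comp φ.symm.injective, fun i => ?_⟩
    rw [isBalanced_iff φ.symm] at hbal
    refine (congrArg card ?_).trans (hbal i)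
    ext j
    rw [mem_filter, mem_filter]
    exact and_congr_right fun _ => Eq.congr_left
      ((pairColor_coe C (f.mapEdgeSet (pathEdge φ.symm j))).trans (hf _))
  · rintro ⟨g, hg, hcnt⟩
    let f : SimpleGraph.Copy (path (3 * k)) (⊤ : SimpleGraph (Fin n)) :=
      ⟨⟨g, fun h => (SimpleGraph.top_adj _ _).2 (hg.ne h.ne)⟩, hg⟩
    refine ⟨⟨3 * k + 1, path (3 * k), fun e => C (f.mapEdgeSet e)⟩,
      ⟨⟨SimpleGraph.Iso.refl⟩, ?_⟩, f, fun e => rfl⟩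
    rw [isBalanced_iff SimpleGraph.Iso.refl]
    intro i
    refine (congrArg card ?_).trans (hcnt i)
    ext j
    rw [mem_filter, mem_filter]
    exact and_congr_right fun _ => Eq.congr_left
      (pairColor_coe C (f.mapEdgeSet (pathEdge SimpleGraph.Iso.refl j))).symm

lemma colorCnt_ofFn {V : Type*} (c : Sym2 V → Fin 3) (i : Fin 3) {m : ℕ} (g : Fin (m + 1) → V) :
    colorCnt c i (List.ofFn g) = #{j : Fin m | c s(g j.castSucc, g j.succ) = i} := by
  rw [card_filter]
  induction m with
  | zero => simp [List.ofFn_succ]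
  | succ m ih =>
    rw [Fin.sum_univ_succ, List.ofFn_succ, List.ofFn_succ, colorCnt_cons_cons]
    have := ih (fun j => g j.succ)
    rw [List.ofFn_succ] at this
    rw [this]
    rfl

lemma HasBalancedPath.exists_contains {n k : ℕ} (hk : 1 ≤ k)
    {C : SimpleGraph.TopEdgeLabeling (Fin n) (Fin 3)} (h : HasBalancedPath (pairColor C) k) :
    ∃ H ∈ balancedFamily 3 (path (3 * k)), Contains C H := by
  obtain ⟨l, hnd, hcnt⟩ := h
  have hlen : l.length = 3 * k + 1 := by
    match l with
    | [] =>
      have := hcnt 0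
      simp at this
      omega
    | x :: l =>
      have := colorCnt_add_add (c := pairColor C) (α := 0) (β := 1) (γ := 2)
        ⟨by decide, by decide, by decide⟩ x l
      rw [hcnt, hcnt, hcnt] at this
      simp
      omega
  rw [exists_contains_iff]
  obtain ⟨g, rfl⟩ : ∃ g : Fin (3 * k + 1) → Fin n, l = List.ofFn g := by
    rw [← hlen]
    exact ⟨l.get, (List.ofFn_get l).symm⟩
  exact ⟨g, List.nodup_ofFn.1 hnd, fun i => by rw [← colorCnt_ofFn, hcnt]⟩

end Bridge

/-! ### The lower bound -/

section LowerBound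

/-- The edges between the first `s` vertices and the others get the colours `0` and `1` according
to the parity of their larger end; all other edges get colour `2`. -/
def starPairColor (n s : ℕ) (e : Sym2 (Fin n)) : Fin 3 :=
  if (e.inf : ℕ) < s ∧ s ≤ (e.sup : ℕ) then (if (e.sup : ℕ) % 2 = 0 then 0 else 1) else 2

/-- The edge labelling of `K_n` given by `starPairColor`. -/
def starColoring (n s : ℕ) : SimpleGraph.TopEdgeLabeling (Fin n) (Fin 3) :=
  fun e => starPairColor n s e

lemma le_colorCount_starColoring {n s q : ℕ} {i : Fin 3} (o : ℕ) (y : ℕ → ℕ)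
    (hy : Function.Injective y) (hlt : ∀ a < s, ∀ b < q, o + a < y b) (hn : ∀ b < q, y b < n)
    (hcol : ∀ a < s, ∀ b < q, (if o + a < s ∧ s ≤ y b then
      (if y b % 2 = 0 then (0 : Fin 3) else 1) else 2) = i) :
    s * q ≤ colorCount (starColoring n s) i := by
  have hcard : s * q = Nat.card (Fin s × Fin q) := by simp
  rw [hcard, colorCount]
  have h1 : ∀ p : Fin s × Fin q, o + p.1 < y p.2 := fun p => hlt _ p.1.2 _ p.2.2
  have h2 : ∀ p : Fin s × Fin q, y p.2 < n := fun p => hn _ p.2.2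
  let x' : Fin s × Fin q → Fin n := fun p => ⟨o + p.1, (h1 p).trans (h2 p)⟩
  let y' : Fin s × Fin q → Fin n := fun p => ⟨y p.2, h2 p⟩
  have hxy : ∀ p, x' p < y' p := h1
  refine Nat.card_le_card_of_injective
    (fun p => ⟨⟨s(x' p, y' p), (SimpleGraph.top_adj _ _).2 (hxy p).ne⟩, ?_⟩) ?_
  · rw [← hcol _ p.1.2 _ p.2.2]
    simp only [starColoring, starPairColor, Sym2.inf_mk, Sym2.sup_mk, inf_of_le_left (hxy p).le,
      sup_of_le_right (hxy p).le]
    rfl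
  · intro p p' h
    have h' := congrArg (fun e => (e.1.1 : Sym2 (Fin n))) h
    simp only [Sym2.eq_iff] at h'
    rcases h' with ⟨e1, e2⟩ | ⟨e1, e2⟩
    · have e3 : o + (p.1 : ℕ) = o + p'.1 := congrArg Fin.val e1
      have e4 := hy (show y p.2 = y p'.2 from congrArg Fin.val e2)
      exact Prod.ext (Fin.ext (by omega)) (Fin.ext e4)
    · have h3 := hxy p
      have h4 := hxy p'
      rw [e1, e2] at h3
      exact absurd h3 h4.asymm

lemma le_colorCount {n s q : ℕ} (h : 2 * s + 2 * q ≤ n) (i : Fin 3) :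
    s * q ≤ colorCount (starColoring n s) i := by
  fin_cases i
  · refine le_colorCount_starColoring 0 (fun b => 2 * s + 2 * b) (fun b b' h => ?_)
      (fun a ha b hb => ?_) (fun b hb => ?_) (fun a ha b hb => ?_)
    · dsimp only at h
      omega
    · omega
    · omega
    · rw [if_pos (by omega), if_pos (by omega)]
      rfl
  · refine le_colorCount_starColoring 0 (fun b => 2 * s + 2 * b + 1) (fun b b' h => ?_)
      (fun a ha b hb => ?_) (fun b hb => ?_) (fun a ha b hb => ?_)
    · dsimp only at h
      omega
    · omega
    · omega
    · rw [if_pos (by omega), if_neg (by omega)]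
      rfl
  · refine le_colorCount_starColoring s (fun b => 2 * s + b) (fun b b' h => ?_)
      (fun a ha b hb => ?_) (fun b hb => ?_) (fun a ha b hb => ?_)
    · dsimp only at h
      omega
    · omega
    · omega
    · rw [if_neg (by omega)]
      rfl

/-- A path has at most `2 * s` edges that meet the first `s` vertices, and these include all edges
of the colours `0` and `1`. -/
lemma not_contains_starColoring {n k s : ℕ} (hs : s < k) :
    ¬ ∃ H ∈ balancedFamily 3 (path (3 * k)), Contains (starColoring n s) H := by
  rw [exists_contains_iff]
  rintro ⟨g, hg, hcnt⟩
  have hsmall : #{j : Fin (3 * k + 1) | (g j : ℕ) < s} ≤ s := by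
    have h1 : #{j : Fin (3 * k + 1) | (g j : ℕ) < s} ≤ #(range s) :=
      card_le_card_of_injOn (fun j => (g j : ℕ)) (fun j hj => by simpa using hj)
        (fun j _ j' _ h => hg (Fin.ext h))
    simpa using h1
  have hcol : ∀ j : Fin (3 * k), pairColor (starColoring n s) s(g j.castSucc, g j.succ)
      = starPairColor n s s(g j.castSucc, g j.succ) := fun j => by
    have hadj : s(g j.castSucc, g j.succ) ∈ (⊤ : SimpleGraph (Fin n)).edgeSet :=
      (SimpleGraph.top_adj _ _).2 (hg.ne (path_adj j).ne)
    exact pairColor_coe (starColoring n s) ⟨_, hadj⟩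
  have hsub : ({j | pairColor (starColoring n s) s(g j.castSucc, g j.succ) = 0} :
        Finset (Fin (3 * k))) ∪
      ({j | pairColor (starColoring n s) s(g j.castSucc, g j.succ) = 1} : Finset (Fin (3 * k))) ⊆
      ({j | (g j.castSucc : ℕ) < s} : Finset (Fin (3 * k))) ∪
      ({j | (g j.succ : ℕ) < s} : Finset (Fin (3 * k))) := by
    intro j hj
    simp only [mem_union, mem_filter, mem_univ, true_and, hcol] at hj ⊢
    by_contra! hcon
    have h2 : starPairColor n s s(g j.castSucc, g j.succ) = 2 := by
      rw [starPairColor, if_neg]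
      rintro ⟨h, -⟩
      rw [Sym2.inf_mk] at h
      rcases le_total (g j.castSucc) (g j.succ) with h' | h'
      · rw [inf_of_le_left h'] at h
        omega
      · rw [inf_of_le_right h'] at h
        omega
    rw [h2] at hj
    revert hj
    decide
  have h0 := card_le_card hsub
  rw [card_union_of_disjoint, hcnt, hcnt] at h0
  · have h1 : #{j : Fin (3 * k) | (g j.castSucc : ℕ) < s} ≤ s :=
      (card_le_card_of_injOn Fin.castSucc (fun j hj => by simpa using hj)
        (Fin.castSucc_injective _).injOn).trans hsmall
    have h2 : #{j : Fin (3 * k) | (g j.succ : ℕ) < s} ≤ s :=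
      (card_le_card_of_injOn Fin.succ (fun j hj => by simpa using hj)
        (Fin.succ_injective _).injOn).trans hsmall
    have h3 := card_union_le ({j | (g j.castSucc : ℕ) < s} : Finset (Fin (3 * k)))
      ({j | (g j.succ : ℕ) < s} : Finset (Fin (3 * k)))
    omega
  · rw [disjoint_left]
    intro j hj hj'
    simp only [mem_filter, mem_univ, true_and] at hj hj'
    rw [hj] at hj'
    revert hj'
    decide

end LowerBound

/-! ### The balancing number -/

lemma coloredEx_eq (n : ℕ) (F : Set (ColoredGraph 3)) :
    ∃ b : ℕ, coloredEx 3 n F = b ∧ IsThreshold 3 n F b ∧ ∀ m, IsThreshold 3 n F m → b ≤ m := by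
  classical
  -- no colour can have more edges than `K_n`, so that this many edges are a threshold
  have hex : ∃ m, IsThreshold 3 n F m :=
    ⟨Nat.card (⊤ : SimpleGraph (Fin n)).edgeSet, fun C hC =>
      absurd (hC 0) (not_lt.2 (Finite.card_subtype_le _))⟩
  refine ⟨Nat.find hex, le_antisymm (iInf₂_le _ (Nat.find_spec hex)) ?_, Nat.find_spec hex,
    fun m hm => Nat.find_min' hex hm⟩
  exact le_iInf₂ fun m hm => by exact_mod_cast Nat.find_min' hex hm

lemma le_of_isThreshold {n k m q : ℕ} (hk : 1 ≤ k) (hq : 2 * (k - 1) + 2 * q ≤ n)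
    (h : IsThreshold 3 n (balancedFamily 3 (path (3 * k))) m) : (k - 1) * q ≤ m := by
  by_contra hlt
  exact not_contains_starColoring (n := n) (k := k) (s := k - 1) (by omega)
    (h _ fun i => (not_le.1 hlt).trans_le (le_colorCount hq i))

lemma isThreshold_of_large {n k m : ℕ} (hk : 1 ≤ k) (hm : 7 * errorConst k ≤ m) (hn : m ^ 4 ≤ n)
    (hn' : n ≤ 2 * m ^ 4) :
    IsThreshold 3 n (balancedFamily 3 (path (3 * k))) (k * n + 3 * k * (errorConst k * m ^ 3)) := by
  intro C hC
  refine HasBalancedPath.exists_contains hk ?_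
  have hm5 : 5 ≤ m := by unfold errorConst at hm; omega
  rcases hk.eq_or_lt with rfl | hk
  · refine HasBalancedPath.one ?_ fun i => ?_
    · rw [Fintype.card_fin]
      exact (hm5.trans (Nat.le_self_pow (by norm_num) m)).trans hn
    · have hpos : 0 < volume (colorGraph (pairColor C) i) univ := by
        have := hC i
        rw [volume_eq_two_mul_colorCount]
        omega
      obtain ⟨x, -, hx⟩ := exists_ne_zero_of_sum_ne_zero hpos.ne'
      obtain ⟨y, hy⟩ := card_pos.1 (Nat.pos_of_ne_zero hx)
      exact ⟨x, y, (mem_filter.1 hy).2⟩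
  · refine HasBalancedPath.of_volume hk hm (by simpa) (by simpa) fun i => ?_
    have h1 := hC i
    have h2 : 6 * k * (errorConst k * m ^ 3) = 2 * (3 * k * (errorConst k * m ^ 3)) := by ring
    have h3 : 2 * k * n = 2 * (k * n) := by ring
    rw [volume_eq_two_mul_colorCount, Fintype.card_fin]
    omega

lemma tendsto_sqrt_sqrt : Tendsto (fun n : ℕ => n.sqrt.sqrt) atTop atTop := by
  refine tendsto_atTop.2 fun b => ?_
  filter_upwards [eventually_ge_atTop (b * b * (b * b))] with n hn
  exact Nat.le_sqrt.2 (Nat.le_sqrt.2 hn)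

lemma sqrt_sqrt_pow_four_le (n : ℕ) : n.sqrt.sqrt ^ 4 ≤ n := by
  calc n.sqrt.sqrt ^ 4 = (n.sqrt.sqrt ^ 2) ^ 2 := by ring
    _ ≤ n.sqrt ^ 2 := Nat.pow_le_pow_left (Nat.sqrt_le' _) 2
    _ ≤ n := Nat.sqrt_le' _

lemma le_two_mul_sqrt_sqrt_pow_four {n : ℕ} (h : 15 ≤ n.sqrt.sqrt) : n ≤ 2 * n.sqrt.sqrt ^ 4 := by
  have h1 : n.sqrt + 1 ≤ (n.sqrt.sqrt + 1) ^ 2 := Nat.lt_succ_sqrt' _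
  have h2 : n < (n.sqrt + 1) ^ 2 := Nat.lt_succ_sqrt' _
  have h3 := Nat.pow_le_pow_left h1 2
  generalize n.sqrt.sqrt = m at *
  have h4 : 15 * m ^ 3 ≤ m * m ^ 3 := Nat.mul_le_mul_right _ h
  have h5 : m ^ 2 ≤ m ^ 3 := Nat.pow_le_pow_right (by omega) (by norm_num)
  have h6 : m ≤ m ^ 2 := Nat.le_self_pow (by norm_num) m
  have h7 : ((m + 1) ^ 2) ^ 2 = m * m ^ 3 + 4 * m ^ 3 + 6 * m ^ 2 + 4 * m + 1 := by ring
  have h8 : m ^ 4 = m * m ^ 3 := by ring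
  omega

end BalancedPaths

theorem theorem1p7 (k : ℕ) (hk : 1 ≤ k) :
    ∃ f g : ℕ → ℝ, Tendsto f atTop (𝓝 0) ∧ Tendsto g atTop (𝓝 0) ∧
      ∀ᶠ n : ℕ in atTop, ∃ b : ℕ,
        BalancedPaths.balancingNumber 3 n (BalancedPaths.path (3 * k)) = (b : ℕ∞) ∧
        ((1 / 2 : ℝ) * ((k : ℝ) - 1) + f n) * (n : ℝ) ≤ (b : ℝ) ∧
        (b : ℝ) ≤ ((k : ℝ) + g n) * (n : ℝ) := by
  refine ⟨fun n => -(((k : ℝ) - 1) * k) / n,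
    fun n => 3 * k * (BalancedPaths.errorConst k * n.sqrt.sqrt ^ 3) / n,
    tendsto_const_nhds.div_atTop tendsto_natCast_atTop_atTop, ?_, ?_⟩
  · -- with `m = n.sqrt.sqrt` the error term is at most a constant times `m ^ 3 / m ^ 4`
    refine squeeze_zero' (g := fun n : ℕ =>
      (3 * k * BalancedPaths.errorConst k : ℝ) / (n.sqrt.sqrt : ℝ))
      (Eventually.of_forall fun n => by positivity) ?_
      (tendsto_const_nhds.div_atTop
        (tendsto_natCast_atTop_atTop.comp BalancedPaths.tendsto_sqrt_sqrt))
    filter_upwards [BalancedPaths.tendsto_sqrt_sqrt.eventually_ge_atTop 1] with n hm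
    have h1 : ((n.sqrt.sqrt : ℝ)) ^ 4 ≤ n := by exact_mod_cast BalancedPaths.sqrt_sqrt_pow_four_le n
    have hm' : (1 : ℝ) ≤ n.sqrt.sqrt := by exact_mod_cast hm
    generalize (n.sqrt.sqrt : ℝ) = m at *
    have hm0 : 0 < m := by linarith
    have hn0 : (0 : ℝ) < n := lt_of_lt_of_le (by positivity) h1
    rw [div_le_div_iff₀ hn0 hm0]
    calc (3 : ℝ) * k * (BalancedPaths.errorConst k * m ^ 3) * m
        = (3 : ℝ) * k * BalancedPaths.errorConst k * m ^ 4 := by ring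
      _ ≤ (3 : ℝ) * k * BalancedPaths.errorConst k * n := by gcongr
  · filter_upwards [eventually_ge_atTop (2 * k), BalancedPaths.tendsto_sqrt_sqrt.eventually_ge_atTop
      (7 * BalancedPaths.errorConst k)] with n hn hm
    obtain ⟨b, hb, hthr, hmin⟩ := BalancedPaths.coloredEx_eq n
      (BalancedPaths.balancedFamily 3 (BalancedPaths.path (3 * k)))
    have hn0 : (0 : ℝ) < n := by
      have : 0 < n := by omega
      exact_mod_cast this
    refine ⟨b, hb, ?_, ?_⟩
    · have h1 := BalancedPaths.le_of_isThreshold (q := (n - 2 * (k - 1)) / 2) hk (by omega) hthr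
      have h2 : n ≤ 2 * ((n - 2 * (k - 1)) / 2) + 2 * k := by omega
      generalize (n - 2 * (k - 1)) / 2 = q at h1 h2
      have h1' : ((k : ℝ) - 1) * q ≤ b := by
        rw [← Nat.cast_one, ← Nat.cast_sub hk]
        exact_mod_cast h1
      have h2' : (n : ℝ) ≤ 2 * q + 2 * k := by exact_mod_cast h2
      have hk' : (0 : ℝ) ≤ (k : ℝ) - 1 := by
        rw [sub_nonneg]
        exact_mod_cast hk
      have h3 : (1 / 2 * ((k : ℝ) - 1) + -(((k : ℝ) - 1) * k) / n) * n
          = ((k : ℝ) - 1) * (n / 2 - k) := by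
        field_simp
        ring
      rw [h3]
      refine le_trans (mul_le_mul_of_nonneg_left ?_ hk') h1'
      linarith
    · have h1 := hmin _ (BalancedPaths.isThreshold_of_large hk hm
        (BalancedPaths.sqrt_sqrt_pow_four_le n) (BalancedPaths.le_two_mul_sqrt_sqrt_pow_four (by
          unfold BalancedPaths.errorConst at hm
          omega)))
      have h1' : (b : ℝ) ≤ k * n + 3 * k * (BalancedPaths.errorConst k * n.sqrt.sqrt ^ 3) := by
        exact_mod_cast h1
      rw [add_mul, div_mul_cancel₀ _ hn0.ne']
      exact h1'
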